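/- **Conventions.** $G=(V,E)$ is an unweighted graph on $n$ vertices with Laplacian $L_G$; for $\gamma\ge 0$, $G^\gamma$ is the network with Laplacian $L_G+\gamma I$. $\widetilde G$ is a graph on $V$ with nonnegative edge weights $w$, possibly with a regularization $\tilde\gamma\ge 0$; write $\widetilde B=W^{1/2}B_n\oplus\sqrt{\tilde\gamma}\,I$ (the weighted rows $\sqrt{w_e}\,\mathbf b_e$ followed by those of $\sqrt{\tilde\gamma}I$) and $\widetilde L=\widetilde B^\top\widetilde B$. The effective resistance between $u,v$ in a network with Laplacian $L$ is $R_{uv}=\mathbf b_{uv}^\top L^+\mathbf b_{uv}$, $\mathbf b_{uv}=\chi_u-\chi_v$, and $R_{uv}=\infty$ if $\mathbf b_{uv}$ is not in the range of $L$ (that is, if $u,v$ are not connected). The connectivity of an edge $\{u,v\}$ is the size of a minimum $u$–$v$ cut. $\widetilde O(f)$ means at most $K(\log n)^c f$ with constants $K,c$. **The procedure $\textsc{BallCarving}(SB,E',r,\widetilde G)$.** Here $B$ is the vertex-edge incidence matrix of $G$ and $S$ a sketching matrix with $\operatorname{polylog}(n)$ rows. (1) Update $SB$ by removing the edges of $E'$.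 (2) Run the decoder $\textsc{SpanningForest}$ on the updated sketch to get the connected components of $G'=(V,E\setminus E')$. (3) Put $q=\lceil 10^6\log n\rceil$, let $Q$ be a uniformly random $\pm1$ matrix with $q$ rows, and compute $M=q^{-1/2}Q\widetilde B\widetilde L^+$; write $R^M_{uv}=\frac54\|M\mathbf b_{uv}\|_2^2$. (4) Set $V_{\rm active}=V'=V$. While $V_{\rm active}\neq\emptyset$, let $u$ be its next vertex in a fixed arbitrary order $\pi$, and $C^*$ the component of $G'$ containing $u$. If $\max_{v\in C^*}R^M_{uv}\le r/2$, remove $C^*$ from $V_{\rm active}$. Otherwise output the set $P=\{u\}\cup\{v\in V': R^M_{uv}\le r\}$ and remove $P$ from $V_{\rm active}$ and from $V'$. **Cost model.** Unit-cost real RAM, in which the two subroutines that are used as black boxes are charged nearly linear time and space: a call of $\textsc{SpanningForest}$ is charged $n\operatorname{polylog}(n)$, and applying $\widetilde L^+$ to a vector is charged $(\widetilde m+n)\operatorname{polylog}(n)$, where $\widetilde m$ is the number of edges of $\widetilde G$. **Theorem.** Let $G=(V,E)$ be a graph on $n$ vertices and $E'\subseteq E$, and suppose: 1. The minimum degree of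 $G$ is at least $d\ge 1$. 2. For some $\Gamma\ge1$, $0<r\le 1/\log n$, an integer $k\ge1$ and some $\Delta\in(0,1)$ with $\Delta<\frac{r/\Gamma}{800\sqrt k}$, $V$ has a partition $V=C_1\cup\dots\cup C_k$ such that each induced subgraph $G_{C_i}$ has effective resistance diameter at most $\Delta$. 3. For some $\gamma\ge0$ such that $G^\gamma$ is connected (that is, $\gamma>0$ or $G$ is connected), $R^{G^\gamma}_{uv}\le R^{\widetilde G}_{uv}\le 2\Gamma R^{G^\gamma}_{uv}$ for all $u,v\in V$; and $\widetilde G$ has at most $\frac{n}{\epsilon^2}\operatorname{polylog}(n)$ edges, where $\epsilon>0$. 4. $E'$ contains all edges of $G$ of connectivity at most $d$. 5. $SB$ is a sketch of the required kind: $S$ has at most $\operatorname{polylog}(n)$ rows and $\textsc{SpanningForest}$, applied to the sketch of $G'=(V,E\setminus E')$ under $S$, returns the connected components of $G'$. Then, for every order $\pi$, with probability at least $1-n^{-10}$ over $Q$: $\textsc{BallCarving}(SB,E',r,\widetilde G)$ returns pairwise disjoint sets $P$ with $R^{\widetilde G}_{uv}\le 2r$ for all $u,v\in P$; at most $\widetilde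 O\big(\sqrt k+\frac{k\Gamma}{rd}\big)$ of them are not singletons; the update of the sketch in step (1) takes $\widetilde O(|E'|)$ time, and all the remaining steps together take $\widetilde O\big(n\sqrt k+n\frac{k\Gamma}{rd}+\frac n{\epsilon^2}\big)$ time; the whole procedure uses $\widetilde O\big(n\sqrt k+n\frac{k\Gamma}{rd}+\frac n{\epsilon^2}\big)$ space (besides the list $E'$, which is only read once). The constants in $\widetilde O$ depend only on the exponents of the $\operatorname{polylog}(n)$ factors above. -/

import Mathlib

noncomputable section

namespace BallCarving

/-! ### Effective resistance -/

/-- The vector `χ_u - χ_v`. -/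
def bvec {V : Type*} [DecidableEq V] (u v : V) : V → ℝ :=
  Pi.single u 1 - Pi.single v 1

open Classical in
/-- The Moore–Penrose pseudoinverse of a symmetric real matrix `A = U diag(μ) Uᵀ`, namely
`U diag(μ⁺) Uᵀ` with `μ⁺ = μ⁻¹` for `μ ≠ 0` and `0⁺ = 0`.  (It is only used for symmetric
matrices; `isPseudoinverse_pinv` checks the defining equations.) -/
def pinv {V : Type*} [Fintype V] [DecidableEq V] (A : Matrix V V ℝ) : Matrix V V ℝ :=
  if h : A.IsHermitian then
    (h.eigenvectorUnitary : Matrix V V ℝ) * Matrix.diagonal (fun i => (h.eigenvalues i)⁻¹) *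
      (star h.eigenvectorUnitary : Matrix V V ℝ)
  else 0

/-- The four Penrose equations characterising the pseudoinverse. -/
theorem isPseudoinverse_pinv {V : Type*} [Fintype V] [DecidableEq V] (A : Matrix V V ℝ)
    (h : A.IsHermitian) :
    A * pinv A * A = A ∧ pinv A * A * pinv A = pinv A ∧
      (A * pinv A).IsHermitian ∧ (pinv A * A).IsHermitian := by
  have hp : pinv A = (h.eigenvectorUnitary : Matrix V V ℝ) *
      Matrix.diagonal (fun i => (h.eigenvalues i)⁻¹) *
      (star h.eigenvectorUnitary : Matrix V V ℝ) := by
    rw [pinv, dif_pos h]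
  have hA : A = (h.eigenvectorUnitary : Matrix V V ℝ) * Matrix.diagonal h.eigenvalues *
      (star h.eigenvectorUnitary : Matrix V V ℝ) := by
    have := h.spectral_theorem
    simpa [Unitary.conjStarAlgAut_apply, Function.comp_def] using this
  have hU : (star h.eigenvectorUnitary : Matrix V V ℝ) * (h.eigenvectorUnitary : Matrix V V ℝ) = 1 :=
    Unitary.coe_star_mul_self h.eigenvectorUnitary
  set U : Matrix V V ℝ := (h.eigenvectorUnitary : Matrix V V ℝ)
  set W : Matrix V V ℝ := (star h.eigenvectorUnitary : Matrix V V ℝ)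
  have key : ∀ f g : V → ℝ, U * Matrix.diagonal f * W * (U * Matrix.diagonal g * W) =
      U * Matrix.diagonal (fun i => f i * g i) * W := by
    intro f g
    calc _ = U * Matrix.diagonal f * (W * U) * Matrix.diagonal g * W := by
          simp only [Matrix.mul_assoc]
      _ = _ := by
          rw [hU, Matrix.mul_one, Matrix.mul_assoc U, Matrix.diagonal_mul_diagonal]
  have herm : ∀ f : V → ℝ, (U * Matrix.diagonal f * W).IsHermitian := by
    intro f
    have hW : W = U.conjTranspose := rfl
    rw [hW]
    exact Matrix.isHermitian_mul_mul_conjTranspose U (Matrix.isHermitian_diagonal f)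
  have e1 : A * pinv A = U * Matrix.diagonal
      (fun i => h.eigenvalues i * (h.eigenvalues i)⁻¹) * W := by
    rw [hp, ← key, ← hA]
  have e2 : pinv A * A = U * Matrix.diagonal
      (fun i => (h.eigenvalues i)⁻¹ * h.eigenvalues i) * W := by
    rw [hp, ← key, ← hA]
  refine ⟨?_, ?_, e1 ▸ herm _, e2 ▸ herm _⟩
  · conv_lhs => rw [e1]; rhs; rw [hA]
    rw [key]
    conv_rhs => rw [hA]
    congr 3
    funext i
    exact mul_inv_mul_cancel _
  · rw [e2, hp, key]
    congr 3
    funext i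
    by_cases hi : h.eigenvalues i = 0 <;> simp [hi]

open Classical in
/-- Effective resistance between `u` and `v` in the network with (possibly regularized) Laplacian
`L`: it is `b_{uv}ᵀ L⁺ b_{uv}` if a unit current can be sent from `u` to `v`, that is if
`b_{uv}` lies in the range of `L`, and it is infinite otherwise. -/
def effRes {V : Type*} [Fintype V] [DecidableEq V] (L : Matrix V V ℝ) (u v : V) : ENNReal :=
  if ∃ x : V → ℝ, L.mulVec x = bvec u v then
    ENNReal.ofReal (bvec u v ⬝ᵥ (pinv L).mulVec (bvec u v))
  else ⊤

open Classical in
/-- The Laplacian of an unweighted graph. -/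
def lap {V : Type*} [Fintype V] [DecidableEq V] (G : SimpleGraph V) : Matrix V V ℝ :=
  G.lapMatrix ℝ

/-- The Laplacian `L_G + γ I` of the regularized graph `G^γ`. -/
def lapReg {V : Type*} [Fintype V] [DecidableEq V] (G : SimpleGraph V) (γ : ℝ) :
    Matrix V V ℝ :=
  lap G + γ • (1 : Matrix V V ℝ)

open Classical in
/-- The subgraph induced by `C` has effective resistance diameter at most `Δ`. -/
def InducedDiamLE {V : Type*} [Fintype V] [DecidableEq V] (G : SimpleGraph V) (C : Set V)
    (Δ : ℝ) : Prop :=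
  ∀ u v : C, effRes (lap (G.induce C)) u v ≤ ENNReal.ofReal Δ

open Classical in
/-- The number of neighbours of `v`. -/
def deg {V : Type*} [Fintype V] (G : SimpleGraph V) (v : V) : ℕ := G.degree v

open Classical in
/-- The size of a minimum cut separating `u` from `v`. -/
def edgeConn {V : Type*} [Fintype V] [DecidableEq V] (G : SimpleGraph V) (u v : V) : ℕ :=
  sInf {m | ∃ S : Finset V, u ∈ S ∧ v ∉ S ∧ (G.interedges S Sᶜ).card = m}

/-! ### Incidence matrices, weighted regularized graphs, sketches -/

/-- The `n.choose 2` unordered pairs of distinct vertices. -/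
abbrev Pairs (n : ℕ) : Type := {e : Sym2 (Fin n) // ¬ e.IsDiag}

/-- The row `χ_u - χ_v` of a pair `e = {u, v}`, oriented so that `u < v`. -/
def prow {n : ℕ} (e : Pairs n) : Fin n → ℝ := bvec e.1.inf e.1.sup

open Classical in
/-- The vertex-edge incidence matrix of `G`; rows of non-edges are zero. -/
def incidence {n : ℕ} (G : SimpleGraph (Fin n)) : Matrix (Pairs n) (Fin n) ℝ :=
  fun e x => if e.1 ∈ G.edgeSet then prow e x else 0

/-- `G` with the edges in `F` removed. -/
def without {n : ℕ} (G : SimpleGraph (Fin n)) (F : Finset (Pairs n)) : SimpleGraph (Fin n) :=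
  G.deleteEdges (Subtype.val '' (F : Set (Pairs n)))

/-- A graph with nonnegative edge weights (weight `0` means no edge), plus a regularization
`reg · I`; a plain weighted graph has `reg = 0`. -/
structure WGraph (n : ℕ) where
  w : Pairs n → ℝ
  reg : ℝ
  w_nonneg : ∀ e, 0 ≤ w e
  reg_nonneg : 0 ≤ reg

namespace WGraph

variable {n : ℕ} (H : WGraph n)

/-- The matrix `W^{1/2} B ⊕ √reg I`. -/
def inc : Matrix (Pairs n ⊕ Fin n) (Fin n) ℝ :=
  Matrix.of (Sum.elim (fun e => Real.sqrt (H.w e) • prow e)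
    (fun v => Real.sqrt H.reg • Pi.single v 1))

/-- The Laplacian `Bᵀ W B + reg · I`. -/
def laplacian : Matrix (Fin n) (Fin n) ℝ := H.inc.transpose * H.inc

open Classical in
/-- The edges. -/
def edges : Finset (Pairs n) := Finset.univ.filter fun e => H.w e ≠ 0

end WGraph

/-! ### Cost model

Unit-cost real RAM: one elementary operation on vertices or reals (arithmetic, square root,
comparison, reading or writing one memory cell, drawing one random sign) is one time step, one
memory cell holds one vertex or one real.  No memory is reused, so `space`, the number of cells
ever reserved, bounds the peak memory.  The two black boxes that the procedure invokes, the decoder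
`SpanningForest` and a solver for linear systems in a Laplacian, are subroutines whose time and
space are charged as `size * (⌊log₂ n⌋ + 1) ^ a`, for an arbitrary exponent `a`. -/

/-- A result together with the time and space spent on computing it. -/
structure Costed (α : Type) where
  val : α
  time : ℕ
  space : ℕ

instance : Monad Costed where
  pure x := ⟨x, 0, 0⟩
  bind x f := ⟨(f x.val).val, x.time + (f x.val).time, x.space + (f x.val).space⟩

/-- `t` elementary operations. -/
def tick (t : ℕ) : Costed Unit := ⟨(), t, 0⟩

/-- Reserve and initialise `s` memory cells. -/
def alloc (s : ℕ) : Costed Unit := ⟨(), s, s⟩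

/-- The charge of a nearly-linear-time subroutine on an input of the given size. -/
def nearlyLinear (a n size : ℕ) : ℕ := size * (Nat.log 2 n + 1) ^ a

/-! ### The procedure -/

variable {n : ℕ}

/-- First step: update the sketch `Y = S B` by removing the edges in `F`.  Removing one edge changes
two entries in each of the `s` rows. -/
def removeEdges {s : ℕ} (S : Matrix (Fin s) (Pairs n) ℝ) (Y : Matrix (Fin s) (Fin n) ℝ)
    (F : Finset (Pairs n)) : Costed (Matrix (Fin s) (Fin n) ℝ) :=
  F.toList.foldlM (fun Y e => do
    tick (1 + 10 * s)
    pure (Matrix.of fun i x => Y i x - S i e * prow e x)) Y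

/-- The subroutine `SpanningForest`, run on a sketch; `decode` returns a component label for each
vertex. -/
def spanningForest (a : ℕ) {s : ℕ} (decode : Matrix (Fin s) (Fin n) ℝ → Fin n → Fin n)
    (Y : Matrix (Fin s) (Fin n) ℝ) : Costed (Fin n → Fin n) := do
  alloc (nearlyLinear a n n)
  pure (decode Y)

/-- For each label, the list of the vertices carrying it. -/
def componentLists (label : Fin n → Fin n) : Costed (Fin n → List (Fin n)) := do
  alloc n
  (List.finRange n).foldlM (fun T v => do
    tick 4
    alloc 2
    pure (Function.update T (label v) (v :: T (label v)))) (fun _ => [])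

/-- The number of rows of the embedding. -/
def numRows (n : ℕ) : ℕ := ⌈10 ^ 6 * Real.log n⌉₊

/-- The sign of a random bit. -/
def sgn (b : Bool) : ℝ := if b then 1 else -1

/-- The sample space: sign matrices with `numRows n` rows and one column per row of `WGraph.inc`.
(For `reg = 0` the columns beyond the `n.choose 2` first ones are multiplied by `0`.) -/
abbrev Signs (n : ℕ) : Type := Fin (numRows n) → (Pairs n ⊕ Fin n) → Bool

/-- The subroutine that applies the pseudoinverse of the Laplacian to a vector. -/
def laplacianSolve (a : ℕ) (H : WGraph n) (y : Fin n → ℝ) : Costed (Fin n → ℝ) := do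
  alloc (nearlyLinear a n (H.edges.card + n))
  pure ((pinv H.laplacian).mulVec y)

/-- The combination `σᵀ B̃` of the rows of `B̃`, with random signs `σ`: only the rows of the
edges and the regularization rows are touched. -/
def combineRows (H : WGraph n) (σ : Pairs n ⊕ Fin n → Bool) : Costed (Fin n → ℝ) := do
  alloc n
  let y ← H.edges.toList.foldlM (fun y e => do
    tick 14
    pure (y + (sgn (σ (Sum.inl e)) * Real.sqrt (H.w e)) • prow e)) (0 : Fin n → ℝ)
  (List.finRange n).foldlM (fun y v => do
    tick 7
    pure (Function.update y v (y v + sgn (σ (Sum.inr v)) * Real.sqrt H.reg))) y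

/-- The matrix `M = q^{-1/2} Q B̃ L̃⁺`, computed row by row (`L̃⁺` is symmetric). -/
def embedding (a : ℕ) (H : WGraph n) (Q : Signs n) :
    Costed (Matrix (Fin (numRows n)) (Fin n) ℝ) := do
  alloc (numRows n * n)
  (List.finRange (numRows n)).foldlM (fun M i => do
    let y ← combineRows H (Q i)
    let x ← laplacianSolve a H y
    tick (3 + 4 * n)
    pure (M.updateRow i ((Real.sqrt (numRows n))⁻¹ • x))) 0

/-- `‖M (χ_u - χ_v)‖²`. -/
def sqDist {q : ℕ} (M : Matrix (Fin q) (Fin n) ℝ) (u v : Fin n) : Costed ℝ :=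
  (List.finRange q).foldlM (fun s i => do
    tick 6
    pure (s + (M i u - M i v) ^ 2)) 0

/-- `R^M_{uv} = (5/4) ‖M (χ_u - χ_v)‖²`. -/
def resM {q : ℕ} (M : Matrix (Fin q) (Fin n) ℝ) (u v : Fin n) : Costed ℝ := do
  let s ← sqDist M u v
  tick 1
  pure (5 / 4 * s)

/-- `R^M_{u,C} = max_{v ∈ C} R^M_{uv}`. -/
def maxResM {q : ℕ} (M : Matrix (Fin q) (Fin n) ℝ) (u : Fin n) (C : List (Fin n)) :
    Costed ℝ :=
  C.foldlM (fun R v => do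
    let s ← resM M u v
    tick 4
    pure (max R s)) 0

/-- The set `{u} ∪ {v ∈ A \ {u} : R^M_{uv} ≤ r}`; sets are stored as lists and subsets `A` of the
vertex set as Boolean arrays. -/
def carve {q : ℕ} (M : Matrix (Fin q) (Fin n) ℝ) (r : ℝ) (A : Finset (Fin n)) (u : Fin n) :
    Costed (Finset (Fin n)) := do
  alloc 2
  (List.finRange n).foldlM (fun P v => do
    tick 4
    if v ∈ A \ {u} then
      let s ← resM M u v
      tick 1
      if s ≤ r then
        alloc 2
        pure (insert v P)
      else pure P
    else pure P) {u}

/-- The variables of the main loop: `V_active`, `V'` and the sets output so far. -/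
structure LoopState (n : ℕ) where
  active : Finset (Fin n)
  rest : Finset (Fin n)
  out : List (Finset (Fin n))

/-- One iteration of the main loop at the vertex `u`; vertices that are no longer active are
skipped. -/
def visit {q : ℕ} (M : Matrix (Fin q) (Fin n) ℝ) (r : ℝ) (comp : Fin n → List (Fin n))
    (X : LoopState n) (u : Fin n) : Costed (LoopState n) := do
  tick 3
  if u ∈ X.active then
    let R ← maxResM M u (comp u)
    tick 4
    if R ≤ r / 2 then
      tick (3 * (comp u).length)
      pure { X with active := X.active \ (comp u).toFinset }
    else
      let P ← carve M r X.rest u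
      tick (6 * P.card)
      alloc 2
      pure { active := X.active \ P, rest := X.rest \ P, out := X.out ++ [P] }
  else pure X

/-- All the steps after the update of the sketch.  The active vertices are visited
in the order `π 0, π 1, …`; as `V_active` only shrinks, and loses every visited vertex, one pass
through this order visits the next active vertex each time, until none is left. -/
def carveFromSketch (a : ℕ) {s : ℕ} (decode : Matrix (Fin s) (Fin n) ℝ → Fin n → Fin n)
    (Y : Matrix (Fin s) (Fin n) ℝ) (r : ℝ) (H : WGraph n) (π : Equiv.Perm (Fin n))
    (Q : Signs n) : Costed (List (Finset (Fin n))) := do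
  alloc (s * n + 3 * H.edges.card + 2) -- room for the sketch, the graph `H` and `r`
  let label ← spanningForest a decode Y
  let lists ← componentLists label
  let M ← embedding a H Q
  alloc (2 * n) -- room for `V_active` and `V'`
  let X ← ((List.finRange n).map π).foldlM (visit M r fun u => lists (label u))
    { active := Finset.univ, rest := Finset.univ, out := [] }
  pure X.out

/-- The procedure `BallCarving(S B, F, r, H)` with vertex order `π` and random signs `Q`. -/
def ballCarving (a : ℕ) {s : ℕ} (S : Matrix (Fin s) (Pairs n) ℝ)
    (decode : Matrix (Fin s) (Fin n) ℝ → Fin n → Fin n) (Y : Matrix (Fin s) (Fin n) ℝ)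
    (F : Finset (Pairs n)) (r : ℝ) (H : WGraph n) (π : Equiv.Perm (Fin n)) (Q : Signs n) :
    Costed (List (Finset (Fin n))) := do
  let Z ← removeEdges S Y F
  carveFromSketch a decode Z r H π Q

end BallCarving

end

set_option linter.unusedSectionVars false

noncomputable section

namespace BallCarving

/-! ### Dirichlet forms and effective resistances -/

section Dirichlet

variable {V : Type*} [Fintype V] [DecidableEq V]

/-! Randomness enters only through norm preservation. The vector of currents of a pair has squared
norm equal to the resistance in `H` (`sum_currents_sq`), and `R^M` is `5/4` times the mean square of
random signed sums of it. Exponential moments and a union bound over all pairs give `R ≤ R^M ≤ (3/2)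
R` simultaneously with the required probability (`le_uniformOn_of_norm_preserving`,
`resM_embedding_bounds`). The rest is deterministic on this event.

The diameter bound is the triangle inequality for effective resistance (`reff_triangle`), proved by
cutting a potential at one level. For the time, a visit that discards a component is charged to the
vertices of that component, and a visit that outputs a set costs `O(nq)` (`visit_spec`). So the
heart is to bound the number of centres, which also bounds the number of output sets.

By the approximation, centres are pairwise more than `8ρ` apart in `G^γ`, where `ρ = r / (24Γ)`, and
each centre has a vertex of its own component of `G'` outside its `ρ`-ball. Every cut between the
two has at least `d` edges, since a surviving edge has connectivity above `d`
(`le_card_interedges_of_reachable`). Let `θ` be `Δ` times a polylogarithm and consider spheres of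
radius `jθ ≤ ρ`. A cluster has diameter at most `Δ ≤ θ`, so it comes close to only boundedly many of
them. If a centre is near few clusters, most spheres stay away from all vertices, and the `d` edges
crossing such a sphere have resistance above `θ`. The ball then contains starting points of heavy
edges of total resistance at least `dρ/8` (`le_sum_heavyPairs_of_ball`). The other centres each use
up about `ρ/θ` clusters of their own. Hence there are at most `O(kθ/ρ + X/(dρ))` centres
(`card_centres_le`), where `X` is the total resistance of the heavy edges.

It remains to see that `X` is `k` up to logarithms (`sum_heavyPairs_le`). The unit-drop potential of
an edge of resistance at least `τ` has energy at most `1/τ` and is nearly constant on clusters, so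
its level sets are a chain of unions of clusters which few edges can jump over. Region growing finds
a sparse cut in the chain; cutting recursively, at most `k - 1` times, shows that there are only
`Õ(k/τ)` such edges (`card_inside_le_of_sparse_cuts`, `card_le_of_potential`). Summing over `τ`
costs one more logarithm (`sum_le_mul_harmonic`). -/

/-- The real number `b_{uv}ᵀ L⁺ b_{uv}`. -/
def reff (L : Matrix V V ℝ) (u v : V) : ℝ := bvec u v ⬝ᵥ (pinv L).mulVec (bvec u v)

/-- A symmetric matrix whose quadratic form is that of a network with nonnegative conductances and
a uniform nonnegative regularization. -/
structure IsDirichlet (L : Matrix V V ℝ) : Prop where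
  herm : L.IsHermitian
  form : ∃ (c : V → V → ℝ) (g : ℝ), (∀ a b, 0 ≤ c a b) ∧ 0 ≤ g ∧
    ∀ x : V → ℝ, x ⬝ᵥ L.mulVec x = ∑ a, ∑ b, c a b * (x a - x b) ^ 2 + g * ∑ a, x a ^ 2

/-- Every pair of vertices is joined by a unit current. -/
def Conducting (L : Matrix V V ℝ) : Prop := ∀ u v, ∃ x : V → ℝ, L.mulVec x = bvec u v

lemma dotProduct_bvec (x : V → ℝ) (u v : V) : x ⬝ᵥ bvec u v = x u - x v := by
  simp [bvec, dotProduct_sub]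

lemma bvec_dotProduct (x : V → ℝ) (u v : V) : bvec u v ⬝ᵥ x = x u - x v := by
  rw [dotProduct_comm, dotProduct_bvec]

lemma neg_bvec (u v : V) : -bvec u v = bvec v u := by
  simp [bvec]

lemma reff_self (L : Matrix V V ℝ) (u : V) : reff L u u = 0 := by
  simp [reff, bvec]

lemma reff_comm (L : Matrix V V ℝ) (u v : V) : reff L u v = reff L v u := by
  unfold reff
  rw [← neg_bvec v u, Matrix.mulVec_neg]
  simp

lemma dotProduct_mulVec_comm {L : Matrix V V ℝ} (h : L.IsHermitian) (x y : V → ℝ) :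
    x ⬝ᵥ L.mulVec y = y ⬝ᵥ L.mulVec x := by
  have ht : L.transpose = L := by simpa [Matrix.IsHermitian] using h
  rw [Matrix.dotProduct_mulVec, ← Matrix.mulVec_transpose, ht, dotProduct_comm]

lemma IsDirichlet.nonneg {L : Matrix V V ℝ} (h : IsDirichlet L) (x : V → ℝ) :
    0 ≤ x ⬝ᵥ L.mulVec x := by
  obtain ⟨c, g, hc, hg, hf⟩ := h.form
  rw [hf]
  have : ∀ a b, 0 ≤ c a b * (x a - x b) ^ 2 := fun a b => mul_nonneg (hc a b) (sq_nonneg _)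
  exact add_nonneg (Finset.sum_nonneg fun a _ => Finset.sum_nonneg fun b _ => this a b)
    (mul_nonneg hg (Finset.sum_nonneg fun a _ => sq_nonneg _))

lemma IsDirichlet.cauchy_schwarz {L : Matrix V V ℝ} (h : IsDirichlet L) (x y : V → ℝ) :
    (x ⬝ᵥ L.mulVec y) ^ 2 ≤ (x ⬝ᵥ L.mulVec x) * (y ⬝ᵥ L.mulVec y) := by
  have key : ∀ t : ℝ, 0 ≤ (x ⬝ᵥ L.mulVec x) * (t * t) + (2 * (x ⬝ᵥ L.mulVec y)) * t +
      y ⬝ᵥ L.mulVec y := by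
    intro t
    have := h.nonneg (t • x + y)
    rw [Matrix.mulVec_add, Matrix.mulVec_smul, dotProduct_add, add_dotProduct, add_dotProduct,
      dotProduct_smul, smul_dotProduct, smul_dotProduct, dotProduct_smul,
      dotProduct_mulVec_comm h.herm y x] at this
    simp only [smul_eq_mul] at this
    linarith
  have := discrim_le_zero key
  rw [discrim] at this
  linarith

lemma pinv_isHermitian {L : Matrix V V ℝ} (h : L.IsHermitian) : (pinv L).IsHermitian := by
  have hdef : pinv L = (h.eigenvectorUnitary : Matrix V V ℝ) *
      Matrix.diagonal (fun i => (h.eigenvalues i)⁻¹) *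
      (h.eigenvectorUnitary : Matrix V V ℝ).conjTranspose := by
    rw [pinv, dif_pos h]
    rfl
  rw [hdef]
  exact Matrix.isHermitian_mul_mul_conjTranspose _ (Matrix.isHermitian_diagonal _)

/-- `L L⁺ b = b` for `b` in the range of `L`. -/
lemma mulVec_pinv_mulVec {L : Matrix V V ℝ} (h : L.IsHermitian) {b : V → ℝ}
    (hb : ∃ x, L.mulVec x = b) : L.mulVec ((pinv L).mulVec b) = b := by
  obtain ⟨x, rfl⟩ := hb
  rw [Matrix.mulVec_mulVec, Matrix.mulVec_mulVec, (isPseudoinverse_pinv L h).1]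

lemma exists_potential {L : Matrix V V ℝ} (h : L.IsHermitian) {u v : V}
    (hb : ∃ x, L.mulVec x = bvec u v) :
    ∃ ψ : V → ℝ, L.mulVec ψ = bvec u v ∧ ψ u - ψ v = reff L u v ∧
      ψ ⬝ᵥ L.mulVec ψ = reff L u v := by
  refine ⟨(pinv L).mulVec (bvec u v), mulVec_pinv_mulVec h hb, ?_, ?_⟩
  · rw [reff, bvec_dotProduct]
  · rw [mulVec_pinv_mulVec h hb, reff, dotProduct_comm]

lemma reff_nonneg {L : Matrix V V ℝ} (h : IsDirichlet L) {u v : V}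
    (hb : ∃ x, L.mulVec x = bvec u v) : 0 ≤ reff L u v := by
  obtain ⟨ψ, -, -, h2⟩ := exists_potential h.herm hb
  rw [← h2]
  exact h.nonneg ψ

/-- Cauchy–Schwarz for the energy form, applied to `x` and the potential of a unit current. This is
the variational form of resistance through which all later comparisons go. -/
lemma sq_sub_le_reff_mul {L : Matrix V V ℝ} (h : IsDirichlet L) {u v : V}
    (hb : ∃ x, L.mulVec x = bvec u v) (x : V → ℝ) :
    (x u - x v) ^ 2 ≤ reff L u v * (x ⬝ᵥ L.mulVec x) := by
  obtain ⟨ψ, h1, -, h2⟩ := exists_potential h.herm hb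
  have := h.cauchy_schwarz x ψ
  rw [h1, dotProduct_bvec, ← h1, h2] at this
  linarith

/-- Contractions that fix `0` decrease the energy. -/
lemma IsDirichlet.contraction {L : Matrix V V ℝ} (h : IsDirichlet L) (f : ℝ → ℝ)
    (hf : ∀ s t, (f s - f t) ^ 2 + ((s - f s) - (t - f t)) ^ 2 ≤ (s - t) ^ 2) (h0 : f 0 = 0)
    (ψ : V → ℝ) :
    (fun a => f (ψ a)) ⬝ᵥ L.mulVec (fun a => f (ψ a)) ≤ (fun a => f (ψ a)) ⬝ᵥ L.mulVec ψ := by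
  set φ : V → ℝ := fun a => f (ψ a) with hφ
  have hsum : φ ⬝ᵥ L.mulVec φ + (ψ - φ) ⬝ᵥ L.mulVec (ψ - φ) ≤ ψ ⬝ᵥ L.mulVec ψ := by
    obtain ⟨c, g, hc, hg, hq⟩ := h.form
    rw [hq, hq, hq]
    have e1 : ∑ a, ∑ b, c a b * (φ a - φ b) ^ 2 + ∑ a, ∑ b, c a b * ((ψ - φ) a - (ψ - φ) b) ^ 2 ≤
        ∑ a, ∑ b, c a b * (ψ a - ψ b) ^ 2 := by
      rw [← Finset.sum_add_distrib]
      refine Finset.sum_le_sum fun a _ => ?_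
      rw [← Finset.sum_add_distrib]
      refine Finset.sum_le_sum fun b _ => ?_
      rw [← mul_add]
      exact mul_le_mul_of_nonneg_left (hf _ _) (hc a b)
    have e2 : ∑ a, φ a ^ 2 + ∑ a, (ψ - φ) a ^ 2 ≤ ∑ a, ψ a ^ 2 := by
      rw [← Finset.sum_add_distrib]
      refine Finset.sum_le_sum fun a _ => ?_
      have := hf (ψ a) 0
      simpa [h0] using this
    nlinarith [mul_le_mul_of_nonneg_left e2 hg]
  have hexp : (ψ - φ) ⬝ᵥ L.mulVec (ψ - φ) =
      ψ ⬝ᵥ L.mulVec ψ - 2 * (φ ⬝ᵥ L.mulVec ψ) + φ ⬝ᵥ L.mulVec φ := by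
    rw [Matrix.mulVec_sub, dotProduct_sub, sub_dotProduct, sub_dotProduct,
      dotProduct_mulVec_comm h.herm ψ φ]
    ring
  linarith

/-- The increments of `f` and of `s - f s` have the same sign and add up to `s - t`, so the sum of
their squares is at most the square of their sum. -/
lemma contraction_of_monotone {f : ℝ → ℝ} (hm : Monotone f) (hm' : Monotone fun s => s - f s)
    (s t : ℝ) : (f s - f t) ^ 2 + ((s - f s) - (t - f t)) ^ 2 ≤ (s - t) ^ 2 := by
  rcases le_total s t with h | h
  · have h1 := hm h
    have h2 := hm' h
    simp only at h2
    nlinarith [mul_nonneg (sub_nonneg.2 h1) (sub_nonneg.2 h2)]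
  · have h1 := hm h
    have h2 := hm' h
    simp only at h2
    nlinarith [mul_nonneg (sub_nonneg.2 h1) (sub_nonneg.2 h2)]

lemma le_of_sq_le_mul {x R : ℝ} (hR : 0 ≤ R) (h : x ^ 2 ≤ R * x) : x ≤ R := by
  by_contra hc
  push Not at hc
  nlinarith

/-- Cut `ψ` at the level `ψ v`. Each of the two pieces has energy at most its own drop from `u` to
`w`, and the variational inequality bounds the upper piece's drop from `u` to `v` and the lower
piece's drop from `v` to `w`. The sign condition makes both truncations fix `0`, as the
regularization term requires. -/
lemma reff_triangle_of_nonneg {L : Matrix V V ℝ} (h : IsDirichlet L) (hL : Conducting L)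
    (u v w : V) {ψ : V → ℝ} (h1 : L.mulVec ψ = bvec u w) (hv : 0 ≤ ψ v) :
    ψ u - ψ w ≤ reff L u v + reff L v w := by
  have hy := h.contraction (fun s => max (s - ψ v) 0)
    (contraction_of_monotone (fun s t hst => max_le_max (by linarith) le_rfl) (fun s t hst => by
      simp only
      rcases le_total (s - ψ v) 0 with h | h <;> rcases le_total (t - ψ v) 0 with h' | h' <;>
        simp [h, h'] <;> linarith)) (by simp [hv]) ψ
  have hz := h.contraction (fun s => min s (ψ v))
    (contraction_of_monotone (fun s t hst => min_le_min hst le_rfl) (fun s t hst => by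
      simp only
      rcases le_total s (ψ v) with h | h <;> rcases le_total t (ψ v) with h' | h' <;>
        simp [h, h'] <;> linarith)) (by simp [hv]) ψ
  rw [h1, dotProduct_bvec] at hy hz
  have hy2 := sq_sub_le_reff_mul h (hL u v) (fun a => max (ψ a - ψ v) 0)
  have hz2 := sq_sub_le_reff_mul h (hL v w) (fun a => min (ψ a) (ψ v))
  have a1 : max (ψ u - ψ v) 0 ≤ reff L u v := by
    apply le_of_sq_le_mul (reff_nonneg h (hL u v))
    have : max (ψ w - ψ v) 0 ≥ 0 := le_max_right _ _
    simp only [sub_self, max_self, sub_zero] at hy2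
    refine hy2.trans (mul_le_mul_of_nonneg_left (hy.trans (by linarith)) (reff_nonneg h (hL u v)))
  have a2 : ψ v - min (ψ w) (ψ v) ≤ reff L v w := by
    apply le_of_sq_le_mul (reff_nonneg h (hL v w))
    have : min (ψ u) (ψ v) ≤ ψ v := min_le_right _ _
    simp only [min_self] at hz2
    refine hz2.trans (mul_le_mul_of_nonneg_left (hz.trans (by linarith)) (reff_nonneg h (hL v w)))
  have a3 := le_max_left (ψ u - ψ v) 0
  have a4 := min_le_left (ψ w) (ψ v)
  linarith

/-- Effective resistance satisfies the triangle inequality. -/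
lemma reff_triangle {L : Matrix V V ℝ} (h : IsDirichlet L) (hL : Conducting L) (u v w : V) :
    reff L u w ≤ reff L u v + reff L v w := by
  obtain ⟨ψ, h1, h2, -⟩ := exists_potential h.herm (hL u w)
  rw [← h2]
  rcases le_total 0 (ψ v) with hv | hv
  · exact reff_triangle_of_nonneg h hL u v w h1 hv
  -- The negated potential drives the current from `w` to `u` and is nonnegative at `v`.
  · have := reff_triangle_of_nonneg h hL w v u (ψ := -ψ)
      (by rw [Matrix.mulVec_neg, h1, neg_bvec]) (by simpa using hv)
    rw [reff_comm L u v, reff_comm L v w]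
    simp only [Pi.neg_apply] at this
    linarith

/-- The resistance is at most any constant in the inequality of `sq_sub_le_reff_mul`. -/
lemma reff_le_of_sq_sub_le {L : Matrix V V ℝ} (h : L.IsHermitian) {u v : V} {c : ℝ} (hc : 0 ≤ c)
    (hb : ∃ x, L.mulVec x = bvec u v)
    (hx : ∀ x : V → ℝ, (x u - x v) ^ 2 ≤ c * (x ⬝ᵥ L.mulVec x)) : reff L u v ≤ c := by
  obtain ⟨ψ, -, h1, h2⟩ := exists_potential h hb
  have := hx ψ
  rw [h1, h2] at this
  exact le_of_sq_le_mul hc this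

/-- If the kernel of `L` is orthogonal to `b_{uv}`, then `b_{uv}` is in the range of `L`. -/
lemma exists_mulVec_eq_bvec {L : Matrix V V ℝ} (h : L.IsHermitian) {u v : V}
    (hker : ∀ z, L.mulVec z = 0 → z u = z v) : ∃ x, L.mulVec x = bvec u v := by
  obtain ⟨p1, p2, p3, p4⟩ := isPseudoinverse_pinv L h
  have t : ∀ {A : Matrix V V ℝ}, A.IsHermitian → A.transpose = A := fun hA => by
    simpa [Matrix.IsHermitian] using hA
  set b := bvec u v
  set P := pinv L
  set z := b - (P * L).mulVec b with hz
  have hLz : L.mulVec z = 0 := by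
    rw [hz, Matrix.mulVec_sub, Matrix.mulVec_mulVec, ← Matrix.mul_assoc, p1, sub_self]
  have hzb : z ⬝ᵥ b = 0 := by rw [dotProduct_bvec, hker z hLz, sub_self]
  have hzP : z ⬝ᵥ (P * L).mulVec b = 0 := by
    rw [dotProduct_mulVec_comm p4, ← Matrix.mulVec_mulVec, hLz]
    simp
  -- `z` is the component of `b` in the kernel: it is orthogonal both to `b` and to `P L b`, hence
  -- to itself.
  have hzz : z ⬝ᵥ z = 0 := by
    conv_lhs => rhs; rw [hz]
    rw [dotProduct_sub, hzb, hzP, sub_self]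
  have hz0 : z = 0 := dotProduct_self_eq_zero.1 hzz
  have hb : (P * L).mulVec b = b := (sub_eq_zero.1 hz0).symm
  have hc : L * P = (P * L).transpose := by
    rw [Matrix.transpose_mul, t (pinv_isHermitian h), t h]
  refine ⟨P.mulVec b, ?_⟩
  rw [Matrix.mulVec_mulVec, hc, t p4, hb]

lemma effRes_eq_of_exists {L : Matrix V V ℝ} {u v : V} (hb : ∃ x, L.mulVec x = bvec u v) :
    effRes L u v = ENNReal.ofReal (reff L u v) := by
  rw [effRes, if_pos hb, reff]

lemma exists_of_effRes_ne_top {L : Matrix V V ℝ} {u v : V} (hb : effRes L u v ≠ ⊤) :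
    ∃ x, L.mulVec x = bvec u v := by
  by_contra h
  exact hb (by rw [effRes, if_neg h])

lemma Conducting.effRes_eq {L : Matrix V V ℝ} (hL : Conducting L) (u v : V) :
    effRes L u v = ENNReal.ofReal (reff L u v) := effRes_eq_of_exists (hL u v)

end Dirichlet

/-! ### Laplacians -/

section Laplacian

variable {V : Type*} [Fintype V] [DecidableEq V]

open Classical in
/-- Twice the energy of a potential: every edge is counted in both directions. -/
def dartEnergy (G : SimpleGraph V) (x : V → ℝ) : ℝ :=
  ∑ a, ∑ b, if G.Adj a b then (x a - x b) ^ 2 else 0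

lemma lap_form (G : SimpleGraph V) (x : V → ℝ) :
    x ⬝ᵥ (lap G).mulVec x = dartEnergy G x / 2 := by
  classical
  have := G.lapMatrix_toLinearMap₂' (R := ℝ) x
  rw [Matrix.toLinearMap₂'_apply'] at this
  unfold lap dartEnergy
  convert this using 2

lemma lap_isHermitian (G : SimpleGraph V) : (lap G).IsHermitian := by
  classical
  exact G.isHermitian_lapMatrix ℝ

lemma lapReg_form (G : SimpleGraph V) (γ : ℝ) (x : V → ℝ) :
    x ⬝ᵥ (lapReg G γ).mulVec x = dartEnergy G x / 2 + γ * ∑ a, x a ^ 2 := by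
  rw [lapReg, Matrix.add_mulVec, dotProduct_add, lap_form, Matrix.smul_mulVec, Matrix.one_mulVec,
    dotProduct_smul]
  simp [dotProduct, sq]

lemma lapReg_isDirichlet (G : SimpleGraph V) {γ : ℝ} (hγ : 0 ≤ γ) : IsDirichlet (lapReg G γ) := by
  classical
  refine ⟨?_, fun a b => if G.Adj a b then 1 / 2 else 0, γ, ?_, hγ, ?_⟩
  · refine (lap_isHermitian G).add ?_
    have : (γ • (1 : Matrix V V ℝ)) = Matrix.diagonal fun _ => γ := by
      ext i j; simp [Matrix.one_apply, Matrix.diagonal_apply]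
    rw [this]
    exact Matrix.isHermitian_diagonal _
  · intro a b
    simp only
    split_ifs <;> norm_num
  · intro x
    rw [lapReg_form, dartEnergy, Finset.sum_div]
    congr 1
    refine Finset.sum_congr rfl fun a _ => ?_
    rw [Finset.sum_div]
    refine Finset.sum_congr rfl fun b _ => ?_
    by_cases hab : G.Adj a b
    · simp only [hab, if_true]
      ring
    · simp [hab]

lemma lap_isDirichlet (G : SimpleGraph V) : IsDirichlet (lap G) := by
  simpa [lapReg] using lapReg_isDirichlet G (le_refl 0)

lemma dartEnergy_nonneg (G : SimpleGraph V) (x : V → ℝ) : 0 ≤ dartEnergy G x := by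
  refine Finset.sum_nonneg fun a _ => Finset.sum_nonneg fun b _ => ?_
  split_ifs
  · exact sq_nonneg _
  · exact le_rfl

lemma dartEnergy_le_lapReg_form (G : SimpleGraph V) {γ : ℝ} (hγ : 0 ≤ γ) (x : V → ℝ) :
    dartEnergy G x / 2 ≤ x ⬝ᵥ (lapReg G γ).mulVec x := by
  rw [lapReg_form]
  have := mul_nonneg hγ (Finset.sum_nonneg fun a (_ : a ∈ Finset.univ) => sq_nonneg (x a))
  linarith

lemma lapReg_conducting (G : SimpleGraph V) {γ : ℝ} (hγ : 0 ≤ γ) (h : 0 < γ ∨ G.Connected) :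
    Conducting (lapReg G γ) := by
  classical
  intro u v
  refine exists_mulVec_eq_bvec (lapReg_isDirichlet G hγ).herm fun z hz => ?_
  have h0 : dartEnergy G z / 2 + γ * ∑ a, z a ^ 2 = 0 := by rw [← lapReg_form, hz, dotProduct_zero]
  have hs : 0 ≤ ∑ a, z a ^ 2 := Finset.sum_nonneg fun a _ => sq_nonneg _
  have hd := dartEnergy_nonneg G z
  -- A kernel vector has zero energy: it vanishes if `γ > 0`, and is constant if the graph is
  -- connected.
  rcases h with h | h
  · have : ∑ a, z a ^ 2 = 0 := by nlinarith [mul_nonneg hγ hs]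
    rw [Finset.sum_eq_zero_iff_of_nonneg fun a _ => sq_nonneg _] at this
    have hu := this u (Finset.mem_univ _)
    have hv := this v (Finset.mem_univ _)
    rw [pow_eq_zero_iff two_ne_zero] at hu hv
    rw [hu, hv]
  · have hd0 : dartEnergy G z = 0 := by nlinarith [mul_nonneg hγ hs]
    have hL : Matrix.toLinearMap₂' ℝ (G.lapMatrix ℝ) z z = 0 := by
      rw [G.lapMatrix_toLinearMap₂' (R := ℝ) z]
      unfold dartEnergy at hd0
      rw [div_eq_zero_iff]
      left
      convert hd0
    exact (G.lapMatrix_toLinearMap₂'_apply'_eq_zero_iff_forall_reachable z).1 hL u v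
      (h.preconnected u v)

lemma dartEnergy_induce_le (G : SimpleGraph V) (C : Set V) [Fintype C] [DecidableEq C]
    (x : V → ℝ) : dartEnergy (G.induce C) (fun a => x a) ≤ dartEnergy G x := by
  classical
  unfold dartEnergy
  have hpos : ∀ a b, 0 ≤ (if G.Adj a b then (x a - x b) ^ 2 else 0) := fun a b => by
    split_ifs
    · exact sq_nonneg _
    · exact le_rfl
  have hsub : ∀ g : V → ℝ, (∀ a, 0 ≤ g a) → ∑ a : C, g a ≤ ∑ a, g a := by
    intro g hg
    have := Finset.sum_le_sum_of_subset_of_nonneg (f := g) (Finset.subset_univ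
      (Finset.univ.map (Function.Embedding.subtype (· ∈ C)))) fun a _ _ => hg a
    simpa using this
  calc _ ≤ ∑ a : C, ∑ b, (if G.Adj a b then (x a - x b) ^ 2 else 0) := by
        refine Finset.sum_le_sum fun a _ => ?_
        refine le_trans (le_of_eq ?_) (hsub _ (hpos a))
        refine Finset.sum_congr rfl fun b _ => ?_
        simp
    _ ≤ _ := hsub _ fun a => Finset.sum_nonneg fun b _ => hpos a b

/-- In a cluster of small resistance diameter potentials vary little. -/
lemma InducedDiamLE.sq_sub_le {G : SimpleGraph V} {C : Set V} {Δ : ℝ} (hΔ : 0 ≤ Δ)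
    (h : InducedDiamLE G C Δ) {u v : V} (hu : u ∈ C) (hv : v ∈ C) (x : V → ℝ) :
    (x u - x v) ^ 2 ≤ Δ * (dartEnergy G x / 2) := by
  classical
  have huv := h ⟨u, hu⟩ ⟨v, hv⟩
  have hb := exists_of_effRes_ne_top (ne_top_of_le_ne_top ENNReal.ofReal_ne_top huv)
  rw [effRes_eq_of_exists hb, ENNReal.ofReal_le_ofReal_iff hΔ] at huv
  have := sq_sub_le_reff_mul (lap_isDirichlet (G.induce C)) hb (fun a => x a)
  rw [lap_form] at this
  have h2 := dartEnergy_induce_le G C x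
  have h3 := dartEnergy_nonneg (G.induce C) (fun a => x a)
  simp only at this
  refine this.trans (mul_le_mul huv (by linarith) (by linarith) hΔ)

/-- Rayleigh monotonicity: passing from the induced subgraph to `G^γ` only adds energy, so
resistances can only decrease. -/
lemma InducedDiamLE.reff_le {G : SimpleGraph V} {C : Set V} {Δ γ : ℝ} (hΔ : 0 ≤ Δ)
    (h : InducedDiamLE G C Δ) (hγ : 0 ≤ γ) {u v : V} (hu : u ∈ C) (hv : v ∈ C)
    (hL : Conducting (lapReg G γ)) : reff (lapReg G γ) u v ≤ Δ := by
  refine reff_le_of_sq_sub_le (lapReg_isDirichlet G hγ).herm hΔ (hL u v) fun x => ?_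
  exact (h.sq_sub_le hΔ hu hv x).trans
    (mul_le_mul_of_nonneg_left (dartEnergy_le_lapReg_form G hγ x) hΔ)

end Laplacian

/-! ### Laplacians of weighted regularized networks -/

lemma prow_dotProduct {n : ℕ} (x : Fin n → ℝ) (e : Pairs n) :
    prow e ⬝ᵥ x = x e.1.inf - x e.1.sup := bvec_dotProduct x _ _

lemma WGraph.inc_mulVec_inl {n : ℕ} (H : WGraph n) (x : Fin n → ℝ) (e : Pairs n) :
    H.inc.mulVec x (Sum.inl e) = Real.sqrt (H.w e) * (x e.1.inf - x e.1.sup) := by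
  rw [← prow_dotProduct, ← smul_eq_mul, ← smul_dotProduct]
  rfl

lemma WGraph.inc_mulVec_inr {n : ℕ} (H : WGraph n) (x : Fin n → ℝ) (v : Fin n) :
    H.inc.mulVec x (Sum.inr v) = Real.sqrt H.reg * x v := by
  have : H.inc.mulVec x (Sum.inr v) = (Real.sqrt H.reg • Pi.single v (1 : ℝ)) ⬝ᵥ x := rfl
  rw [this, smul_dotProduct]
  simp

lemma WGraph.laplacian_form {n : ℕ} (H : WGraph n) (x y : Fin n → ℝ) :
    x ⬝ᵥ H.laplacian.mulVec y = H.inc.mulVec x ⬝ᵥ H.inc.mulVec y := by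
  rw [WGraph.laplacian, ← Matrix.mulVec_mulVec, Matrix.dotProduct_mulVec, Matrix.vecMul_transpose]

lemma WGraph.laplacian_isHermitian {n : ℕ} (H : WGraph n) : H.laplacian.IsHermitian := by
  simpa [WGraph.laplacian] using Matrix.isHermitian_conjTranspose_mul_self H.inc

lemma WGraph.laplacian_isDirichlet {n : ℕ} (H : WGraph n) : IsDirichlet H.laplacian := by
  classical
  -- The weight of a pair is put on its ordered version `(inf, sup)` only, so no factor `1 / 2` is
  -- needed.
  refine ⟨H.laplacian_isHermitian,
    fun a b => ∑ e : Pairs n, if e.1.inf = a ∧ e.1.sup = b then H.w e else 0, H.reg, ?_,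
    H.reg_nonneg, ?_⟩
  · intro a b
    refine Finset.sum_nonneg fun e _ => ?_
    split_ifs
    · exact H.w_nonneg e
    · exact le_rfl
  · intro x
    rw [H.laplacian_form, dotProduct, Fintype.sum_sum_type]
    congr 1
    · have : ∀ a b : Fin n, (∑ e : Pairs n, if e.1.inf = a ∧ e.1.sup = b then H.w e else 0) *
          (x a - x b) ^ 2 = ∑ e : Pairs n, if e.1.inf = a then
            (if e.1.sup = b then H.w e * (x a - x b) ^ 2 else 0) else 0 := by
        intro a b
        rw [Finset.sum_mul]
        refine Finset.sum_congr rfl fun e _ => ?_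
        by_cases h1 : e.1.inf = a <;> by_cases h2 : e.1.sup = b <;> simp [h1, h2]
      simp_rw [this]
      rw [Finset.sum_congr rfl fun a _ => Finset.sum_comm, Finset.sum_comm]
      refine Finset.sum_congr rfl fun e _ => ?_
      simp only [H.inc_mulVec_inl]
      rw [Finset.sum_eq_single e.1.inf, Finset.sum_eq_single e.1.sup]
      · simp only [if_true]
        have := Real.mul_self_sqrt (H.w_nonneg e)
        linear_combination (x e.1.inf - x e.1.sup) ^ 2 * this
      · intro b _ hb
        simp [Ne.symm hb]
      · simp
      · intro b _ hb
        simp [Ne.symm hb]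
      · simp
    · rw [Finset.mul_sum]
      refine Finset.sum_congr rfl fun v _ => ?_
      rw [H.inc_mulVec_inr]
      have := Real.mul_self_sqrt H.reg_nonneg
      linear_combination x v ^ 2 * this

/-! ### Multigraphs in which every edge can be separated by a long chain of sets -/

section Multigraph

variable {β κ : Type*} [DecidableEq β] [DecidableEq κ] (s t : β → κ) (J : Finset β)

/-- The edges with both ends in `T`. -/
def inside (T : Finset κ) : Finset β := J.filter fun e => s e ∈ T ∧ t e ∈ T

/-- The edges with one end in `A` and the other one in `B`. -/
def between (A B : Finset κ) : Finset β :=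
  J.filter fun e => (s e ∈ A ∧ t e ∈ B) ∨ (s e ∈ B ∧ t e ∈ A)

variable {s t J}

lemma between_comm (A B : Finset κ) : between s t J A B = between s t J B A := by
  unfold between
  congr 1
  ext e
  exact or_comm

lemma inside_mono {A B : Finset κ} (h : A ⊆ B) : inside s t J A ⊆ inside s t J B := by
  intro e he
  simp only [inside, Finset.mem_filter] at he ⊢
  exact ⟨he.1, h he.2.1, h he.2.2⟩

lemma card_inside_eq {A T : Finset κ} (h : A ⊆ T) :
    (inside s t J T).card =
      (inside s t J A).card + (inside s t J (T \ A)).card + (between s t J A (T \ A)).card := by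
  rw [← Finset.card_union_of_disjoint, ← Finset.card_union_of_disjoint]
  · congr 1
    ext e
    have h1 := @h (s e)
    have h2 := @h (t e)
    simp only [inside, between, Finset.mem_union, Finset.mem_filter, Finset.mem_sdiff]
    tauto
  · rw [Finset.disjoint_left]
    intro e
    simp only [inside, between, Finset.mem_union, Finset.mem_filter, Finset.mem_sdiff]
    tauto
  · rw [Finset.disjoint_left]
    intro e
    simp only [inside, Finset.mem_filter, Finset.mem_sdiff]
    tauto

/-- An edge leaving `A` either stays in `B`, and is then new inside `B`, or jumps over `B \ A`. This
is the growth step of region growing. -/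
lemma card_between_le {A B : Finset κ} (T : Finset κ) (hAB : A ⊆ B) :
    (between s t J A (T \ A)).card + (inside s t J A).card ≤
      (inside s t J B).card + (between s t J A (T \ B)).card := by
  rw [card_inside_eq hAB]
  have : between s t J A (T \ A) ⊆ between s t J A (B \ A) ∪ between s t J A (T \ B) := by
    intro e
    have h1 := @hAB (s e)
    have h2 := @hAB (t e)
    simp only [between, Finset.mem_union, Finset.mem_filter, Finset.mem_sdiff]
    tauto
  have := (Finset.card_le_card this).trans (Finset.card_union_le _ _)
  omega

/-- In a long chain of sets some set has few boundary edges. -/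
lemma exists_sparse_in_chain {T : Finset κ} {S : ℕ → Finset κ} {L : ℕ} {N ε : ℝ}
    (hε : 0 ≤ ε) (hL : 1 ≤ L) (hT : ∀ j ≤ L, S j ⊆ T) (hS : ∀ j < L, S j ⊆ S (j + 1))
    (hfar : ∀ j < L, ((between s t J (S j) (T \ S (j + 1))).card : ℝ) ≤ N)
    (hpow : ((inside s t J T).card : ℝ) < (1 + ε) ^ (L - 1)) :
    ∃ j < L, ((between s t J (S j) (T \ S j)).card : ℝ) ≤ ε * (inside s t J (S j)).card + N := by
  by_contra hcon
  push Not at hcon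
  have step : ∀ j < L, (1 + ε) * ((inside s t J (S j)).card : ℝ) < (inside s t J (S (j + 1))).card := by
    intro j hj
    have h1 := hcon j hj
    have h2 := hfar j hj
    have h3 : ((between s t J (S j) (T \ S j)).card : ℝ) + (inside s t J (S j)).card ≤
      (inside s t J (S (j + 1))).card + (between s t J (S j) (T \ S (j + 1))).card := by
      exact_mod_cast card_between_le (s := s) (t := t) (J := J) T (hS j hj)
    linarith
  -- The first step gives only a positive number of inside edges, hence at least one; this is why
  -- the exponent at `S L` is `L - 1`.
  have grow : ∀ j < L, (1 + ε) ^ j ≤ ((inside s t J (S (j + 1))).card : ℝ) := by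
    intro j
    induction j with
    | zero =>
      intro h0
      have h1 := step 0 h0
      have h2 : (0 : ℝ) < (inside s t J (S (0 + 1))).card := lt_of_le_of_lt (by positivity) h1
      have h3 : 0 < (inside s t J (S (0 + 1))).card := by exact_mod_cast h2
      rw [pow_zero]
      exact_mod_cast h3
    | succ j ih =>
      intro hj
      have h1 := step (j + 1) hj
      have h2 := ih (by omega)
      rw [pow_succ, mul_comm]
      exact (mul_le_mul_of_nonneg_left h2 (by linarith)).trans h1.le
  have h1 := grow (L - 1) (by omega)
  rw [Nat.sub_add_cancel hL] at h1
  have h2 : ((inside s t J (S L)).card : ℝ) ≤ (inside s t J T).card := by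
    exact_mod_cast Finset.card_le_card (inside_mono (s := s) (t := t) (J := J) (hT L le_rfl))
  linarith

/-- In a chain of length `2L` there is a sparse cut, bounded in terms of its smaller side. -/
lemma exists_sparse_cut_in_chain {T : Finset κ} {S : ℕ → Finset κ} {L : ℕ} {N ε : ℝ}
    (hε : 0 ≤ ε) (hL : 1 ≤ L) (hT : ∀ j, S j ⊆ T) (hS : ∀ j, S j ⊆ S (j + 1))
    (hfar : ∀ j, ((between s t J (S j) (T \ S (j + 1))).card : ℝ) ≤ N)
    (hpow : ((inside s t J T).card : ℝ) < (1 + ε) ^ (L - 1)) :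
    ∃ j ≤ 2 * L, ∃ A, (A = S j ∨ A = T \ S j) ∧
      ((between s t J A (T \ A)).card : ℝ) ≤ ε * (inside s t J A).card + N ∧
      2 * (inside s t J A).card ≤ (inside s t J T).card := by
  have hmono : Monotone S := monotone_nat_of_le_succ hS
  have hsplit := card_inside_eq (s := s) (t := t) (J := J) (hT L)
  -- The middle set decides which end to search: sets before it lie in `S L`, and complements of
  -- sets after it lie in `T \ S L`. Whichever of these spans fewer edges spans at most half of
  -- them. In the second case the growth argument runs on the reversed chain of complements.
  rcases le_total (inside s t J (S L)).card (inside s t J (T \ S L)).card with hle | hle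
  · obtain ⟨j, hj, hb⟩ := exists_sparse_in_chain hε hL (fun j _ => hT j) (fun j _ => hS j)
      (fun j _ => hfar j) hpow
    refine ⟨j, by omega, S j, Or.inl rfl, hb, ?_⟩
    have := Finset.card_le_card (inside_mono (s := s) (t := t) (J := J) (hmono hj.le))
    omega
  · obtain ⟨j, hj, hb⟩ := exists_sparse_in_chain (S := fun j => T \ S (2 * L - j)) hε hL
      (fun j _ => Finset.sdiff_subset)
      (fun j _ => Finset.sdiff_subset_sdiff le_rfl (hmono (by omega)))
      (fun j hj => by
        have := hfar (2 * L - (j + 1))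
        rw [show 2 * L - (j + 1) + 1 = 2 * L - j by omega, between_comm] at this
        simpa only [Finset.sdiff_sdiff_eq_self (hT _)] using this) hpow
    refine ⟨2 * L - j, by omega, _, Or.inr rfl, hb, ?_⟩
    have : T \ S (2 * L - j) ⊆ T \ S L := Finset.sdiff_subset_sdiff le_rfl (hmono (by omega))
    have := Finset.card_le_card (inside_mono (s := s) (t := t) (J := J) this)
    omega

/-- A multigraph in which every vertex set spanning an edge has a sparse cut has few edges. -/
lemma card_inside_le_of_sparse_cuts {N ε : ℝ} (hN : 0 ≤ N) (hε : 0 ≤ ε)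
    (hcut : ∀ T : Finset κ, (inside s t J T).Nonempty → ∃ A ⊆ T, A.Nonempty ∧ (T \ A).Nonempty ∧
      ((between s t J A (T \ A)).card : ℝ) ≤ ε * (inside s t J A).card + N ∧
      2 * (inside s t J A).card ≤ (inside s t J T).card)
    (c : ℕ) : ∀ (p : ℕ) (T : Finset κ), T.card ≤ c → T.Nonempty → (inside s t J T).card < 2 ^ p →
      ((inside s t J T).card : ℝ) ≤ N * ((T.card : ℝ) - 1) + ε * p * (inside s t J T).card := by
  induction c with
  | zero =>
    intro p T hc hT
    exact absurd hT.card_pos (by omega)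
  | succ c ih =>
    intro p T hc hT hp
    have hT1 : (1 : ℝ) ≤ T.card := by exact_mod_cast hT.card_pos
    rcases (inside s t J T).eq_empty_or_nonempty with he | he
    · rw [he]
      simp only [Finset.card_empty, Nat.cast_zero, mul_zero, add_zero]
      exact mul_nonneg hN (by linarith)
    obtain ⟨A, hA, hA0, hB0, hb, hhalf⟩ := hcut T he
    have hcard := Finset.card_sdiff_add_card_eq_card hA
    have hA1 := hA0.card_pos
    have hB1 := hB0.card_pos
    obtain ⟨p, rfl⟩ : ∃ p', p = p' + 1 := by
      cases p with
      | zero =>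
        have := he.card_pos
        simp at hp
        simp [hp] at this
      | succ p => exact ⟨p, rfl⟩
    -- The side `A` has at most half of the edges, so its exponent drops by one; the saved `ε *
    -- |inside A|` pays for the proportional part of the cut. The additive part `N` is paid by `|T|
    -- - 1 = (|A| - 1) + (|T \ A| - 1) + 1`.
    have e1 := ih p A (by omega) hA0 (by rw [pow_succ] at hp; omega)
    have hsplit := card_inside_eq (s := s) (t := t) (J := J) hA
    have e2 := ih (p + 1) (T \ A) (by omega) hB0 (by omega)
    have hsplit' : ((inside s t J T).card : ℝ) =
      (inside s t J A).card + (inside s t J (T \ A)).card + (between s t J A (T \ A)).card := by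
      exact_mod_cast hsplit
    have hcard' : ((T \ A).card : ℝ) + A.card = T.card := by exact_mod_cast hcard
    rw [hsplit', ← hcard']
    push_cast at e2 ⊢
    have h3 : 0 ≤ ε * (p + 1) * ((between s t J A (T \ A)).card : ℝ) := by positivity
    nlinarith
end Multigraph

/-! ### Edges of large effective resistance between clusters -/

section Clusters

variable {V κ : Type*} [Fintype V] [DecidableEq V] [DecidableEq κ]

/-- Few edges are long with respect to a given potential. -/
lemma card_mul_sq_le_dartEnergy (G : SimpleGraph V) (x : V → ℝ) (J : Finset (V × V))
    (hJ : ∀ e ∈ J, G.Adj e.1 e.2) {h : ℝ} (hlong : ∀ e ∈ J, h ≤ (x e.1 - x e.2) ^ 2) :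
    J.card * h ≤ dartEnergy G x := by
  classical
  calc (J.card : ℝ) * h = ∑ e ∈ J, h := by simp
    _ ≤ ∑ e ∈ J, (if G.Adj e.1 e.2 then (x e.1 - x e.2) ^ 2 else 0) :=
        Finset.sum_le_sum fun e he => by rw [if_pos (hJ e he)]; exact hlong e he
    _ ≤ ∑ e : V × V, (if G.Adj e.1 e.2 then (x e.1 - x e.2) ^ 2 else 0) := by
        refine Finset.sum_le_sum_of_subset_of_nonneg (Finset.subset_univ _) fun e _ _ => ?_
        split_ifs
        · exact sq_nonneg _
        · exact le_rfl
    _ = dartEnergy G x := by rw [Fintype.sum_prod_type]; rfl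

open Classical in
/-- If the ends of every edge in `J` are separated by a potential of energy at most `1 / θ` that is
nearly constant on the clusters, then the multigraph `J` on the clusters has sparse cuts. -/
lemma exists_sparse_cut_of_potential (G : SimpleGraph V) (cl : V → κ) (J : Finset (V × V))
    (hJ : ∀ e ∈ J, G.Adj e.1 e.2) {θ ε : ℝ} (hθ : 0 < θ) (hε : 0 ≤ ε) {L : ℕ} (hL : 1 ≤ L)
    (hpot : ∀ e ∈ J, ∃ x : V → ℝ, x e.1 - x e.2 = 1 ∧ dartEnergy G x ≤ 2 / θ ∧
      ∀ p q, cl p = cl q → |x p - x q| ≤ 1 / (8 * L))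
    (hpow : (J.card : ℝ) < (1 + ε) ^ (L - 1)) (T : Finset κ)
    (hT : (inside (fun e => cl e.1) (fun e => cl e.2) J T).Nonempty) :
    ∃ A ⊆ T, A.Nonempty ∧ (T \ A).Nonempty ∧
      ((between (fun e => cl e.1) (fun e => cl e.2) J A (T \ A)).card : ℝ) ≤
        ε * (inside (fun e => cl e.1) (fun e => cl e.2) J A).card + 128 * L ^ 2 / θ ∧
      2 * (inside (fun e => cl e.1) (fun e => cl e.2) J A).card ≤
        (inside (fun e => cl e.1) (fun e => cl e.2) J T).card := by
  obtain ⟨⟨a, b⟩, he⟩ := hT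
  simp only [inside, Finset.mem_filter] at he
  obtain ⟨heJ, haT, hbT⟩ := he
  obtain ⟨x, hx1, hxE, hxv⟩ := hpot _ heJ
  simp only at hx1
  have hL0 : (1 : ℝ) ≤ L := by exact_mod_cast hL
  -- Spacing of the levels. After `2L` steps the level has dropped by `1/2` out of the total drop
  -- `1`, which leaves room for the variation `η / 2` inside a cluster, so `cl b` never enters the
  -- chain.
  set η : ℝ := 1 / (4 * L) with hη
  have hη0 : 0 < η := by positivity
  have hδ : (1 : ℝ) / (8 * L) = η / 2 := by rw [hη]; field_simp; norm_num
  have hLη : L * η = 1 / 4 := by rw [hη]; field_simp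
  have hη4 : η ≤ 1 / 4 := by nlinarith
  rw [hδ] at hxv
  set S : ℕ → Finset κ := fun j => T.filter fun C => ∃ v, cl v = C ∧ x a - j * η ≤ x v with hS
  have hmem : ∀ j v, cl v ∈ S j → x a - j * η - η / 2 ≤ x v := by
    intro j v hv
    obtain ⟨w, hw1, hw2⟩ := (Finset.mem_filter.1 hv).2
    have := abs_le.1 (hxv w v hw1)
    linarith [this.2]
  have hnot : ∀ j v, cl v ∈ T \ S j → x v < x a - j * η := by
    intro j v hv
    rw [Finset.mem_sdiff] at hv
    by_contra hc
    push Not at hc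
    exact hv.2 (Finset.mem_filter.2 ⟨hv.1, v, rfl, hc⟩)
  obtain ⟨j, hj, A, hA, hb, hhalf⟩ := exists_sparse_cut_in_chain (s := fun e : V × V => cl e.1)
    (t := fun e => cl e.2) (J := J) (T := T) (S := S) (L := L) (N := 128 * L ^ 2 / θ) (ε := ε)
    hε hL (fun j => Finset.filter_subset _ _) (fun j C hC => by
      simp only [hS, Finset.mem_filter] at hC ⊢
      obtain ⟨h1, v, h2, h3⟩ := hC
      refine ⟨h1, v, h2, ?_⟩
      push_cast
      linarith)
    -- An edge that jumps over a layer changes `x` by at least `η - η / 2`, so the energy bound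
    -- admits at most `(2 / θ) / (η / 2) ^ 2 = 128 L² / θ` such edges.
    (fun j => by
      have h1 := card_mul_sq_le_dartEnergy G x
        (between (fun e : V × V => cl e.1) (fun e => cl e.2) J (S j) (T \ S (j + 1)))
        (h := (η / 2) ^ 2)
        (fun e he => hJ e (Finset.mem_filter.1 he).1) (fun e he => by
          rcases (Finset.mem_filter.1 he).2 with ⟨h1, h2⟩ | ⟨h1, h2⟩
          · have h3 := hmem _ _ h1
            have h4 := hnot _ _ h2
            push_cast at h4
            exact pow_le_pow_left₀ (by positivity) (by linarith) 2
          · have h3 := hmem _ _ h2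
            have h4 := hnot _ _ h1
            push_cast at h4
            rw [← neg_sub, neg_sq]
            exact pow_le_pow_left₀ (by positivity) (by linarith) 2)
      have h2 := h1.trans hxE
      rw [← le_div_iff₀ (by positivity)] at h2
      refine h2.trans (le_of_eq ?_)
      rw [hη]
      field_simp
      norm_num)
    (lt_of_le_of_lt (by exact_mod_cast Finset.card_le_card (Finset.filter_subset _ _)) hpow)
  have haS : cl a ∈ S j := Finset.mem_filter.2 ⟨haT, a, rfl, by
    have : 0 ≤ (j : ℝ) * η := by positivity
    linarith⟩
  have hbS : cl b ∈ T \ S j := by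
    rw [Finset.mem_sdiff]
    refine ⟨hbT, fun hc => ?_⟩
    have h1 := hmem _ _ hc
    have h2 : (j : ℝ) ≤ 2 * L := by exact_mod_cast hj
    nlinarith [mul_le_mul_of_nonneg_right h2 hη0.le]
  have hST : S j ⊆ T := Finset.filter_subset _ _
  rcases hA with rfl | rfl
  · exact ⟨S j, hST, ⟨_, haS⟩, ⟨_, hbS⟩, hb, hhalf⟩
  · refine ⟨T \ S j, Finset.sdiff_subset, ⟨_, hbS⟩, ⟨cl a, ?_⟩, hb, hhalf⟩
    rw [Finset.sdiff_sdiff_eq_self hST]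
    exact haS

/-- The number of edges whose ends are separated by a potential of energy at most `1 / θ` that is
nearly constant on the clusters. -/
lemma card_le_of_potential [Fintype κ] [Nonempty κ] (G : SimpleGraph V) (cl : V → κ)
    (J : Finset (V × V)) (hJ : ∀ e ∈ J, G.Adj e.1 e.2) {θ : ℝ} (hθ : 0 < θ) {g : ℕ} (hg : 1 ≤ g)
    (hcard : J.card < 2 ^ (2 * g))
    (hpot : ∀ e ∈ J, ∃ x : V → ℝ, x e.1 - x e.2 = 1 ∧ dartEnergy G x ≤ 2 / θ ∧
      ∀ p q, cl p = cl q → |x p - x q| ≤ 1 / (8 * (8 * g ^ 2 + 1 : ℕ))) :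
    (J.card : ℝ) ≤ 256 * (8 * g ^ 2 + 1) ^ 2 * Fintype.card κ / θ := by
  classical
  have hg0 : (1 : ℝ) ≤ g := by exact_mod_cast hg
  -- By Bernoulli every `4g` growth steps double the number of edges, and `8g² = 4g · 2g` steps
  -- exceed the available `2 ^ (2g)`.
  have hpow : (J.card : ℝ) < (1 + 1 / (4 * (g : ℝ))) ^ ((8 * g ^ 2 + 1) - 1) := by
    have h1 : (2 : ℝ) ≤ (1 + 1 / (4 * (g : ℝ))) ^ (4 * g) := by
      have := one_add_mul_le_pow (a := 1 / (4 * (g : ℝ))) (by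
        have : (0 : ℝ) ≤ 1 / (4 * (g : ℝ)) := by positivity
        linarith) (4 * g)
      refine le_trans (le_of_eq ?_) this
      push_cast
      field_simp
      norm_num
    have h2 : (2 : ℝ) ^ (2 * g) ≤ (1 + 1 / (4 * (g : ℝ))) ^ ((8 * g ^ 2 + 1) - 1) := by
      rw [show (8 * g ^ 2 + 1) - 1 = (4 * g) * (2 * g) by rw [Nat.add_sub_cancel]; ring,
        pow_mul _ (4 * g)]
      exact pow_le_pow_left₀ (by norm_num) h1 _
    exact lt_of_lt_of_le (by exact_mod_cast hcard) h2
  have hcut := exists_sparse_cut_of_potential G cl J hJ hθ (ε := 1 / (4 * (g : ℝ))) (by positivity)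
    (L := 8 * g ^ 2 + 1) (by omega) hpot hpow
  have huniv : inside (fun e : V × V => cl e.1) (fun e => cl e.2) J Finset.univ = J := by
    simp [inside]
  have := card_inside_le_of_sparse_cuts (by positivity) (by positivity) hcut _ (2 * g) Finset.univ
    le_rfl Finset.univ_nonempty (by rwa [huniv])
  rw [huniv, Finset.card_univ] at this
  -- The growth rate `1 / (4g)` times the recursion depth `2g` is `1/2`, so the proportional loss is
  -- absorbed on the left-hand side.
  have e1 : 1 / (4 * (g : ℝ)) * ((2 * g : ℕ) : ℝ) * J.card = J.card / 2 := by
    push_cast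
    field_simp
    norm_num
  rw [e1] at this
  push_cast at this
  have h2 : 128 * (8 * (g : ℝ) ^ 2 + 1) ^ 2 / θ * ((Fintype.card κ : ℝ) - 1) ≤
      128 * (8 * (g : ℝ) ^ 2 + 1) ^ 2 / θ * Fintype.card κ :=
    mul_le_mul_of_nonneg_left (by linarith) (by positivity)
  have h3 : 256 * (8 * (g : ℝ) ^ 2 + 1) ^ 2 * Fintype.card κ / θ =
      2 * (128 * (8 * (g : ℝ) ^ 2 + 1) ^ 2 / θ * Fintype.card κ) := by ring
  rw [h3]
  linarith

end Clusters

/-! ### From counting heavy edges to their total resistance -/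

/-- A weak-type bound for `f` on `J` bounds the sum of `f` up to a logarithm. -/
lemma sum_le_mul_harmonic {β : Type*} [DecidableEq β] (f : β → ℝ) {N : ℝ} (m : ℕ) :
    ∀ J : Finset β, J.card = m → (∀ e ∈ J, 0 ≤ f e) →
      (∀ e ∈ J, ((J.filter fun e' => f e ≤ f e').card : ℝ) * f e ≤ N) →
      ∑ e ∈ J, f e ≤ N * (harmonic m : ℝ) := by
  induction m with
  | zero =>
    intro J hJ _ _
    rw [Finset.card_eq_zero.1 hJ]
    simp
  | succ m ih =>
    intro J hJ h0 hw
    -- Peel off the smallest value: its upper level set is all of `J`, so it is at most `N / (m +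
    -- 1)`. Erasing it only shrinks the remaining upper level sets.
    obtain ⟨e, he, hmin⟩ := Finset.exists_min_image J f (Finset.card_pos.1 (by omega))
    have h1 := hw e he
    rw [Finset.filter_true_of_mem hmin, hJ] at h1
    have h2 := ih (J.erase e) (by rw [Finset.card_erase_of_mem he, hJ]; rfl)
      (fun e' he' => h0 e' (Finset.mem_of_mem_erase he')) (fun e' he' => by
      have hlt := hw e' (Finset.mem_of_mem_erase he')
      refine le_trans (mul_le_mul_of_nonneg_right ?_ (h0 e' (Finset.mem_of_mem_erase he'))) hlt
      exact_mod_cast Finset.card_le_card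
        (Finset.filter_subset_filter _ (Finset.erase_subset _ _)))
    rw [← Finset.add_sum_erase J f he, harmonic_succ]
    push_cast at h1 ⊢
    have h3 : f e ≤ N * ((m : ℝ) + 1)⁻¹ := by
      rw [← div_eq_mul_inv, le_div_iff₀ (by positivity)]
      linarith
    linarith

section Clusters

variable {V κ : Type*} [Fintype V] [DecidableEq V] [DecidableEq κ] [Fintype κ]

open Classical in
/-- The ordered pairs of adjacent vertices of resistance at least `θ`. -/
def heavyPairs (G : SimpleGraph V) (R : V → V → ℝ) (θ : ℝ) : Finset (V × V) :=
  Finset.univ.filter fun e => G.Adj e.1 e.2 ∧ θ ≤ R e.1 e.2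

/-- The total resistance of the edges of large resistance in a graph with `k` clusters of small
diameter is nearly linear in `k`. -/
lemma sum_heavyPairs_le [Nonempty κ] (G : SimpleGraph V) (cl : V → κ) {Δ γ : ℝ} (hΔ : 0 < Δ)
    (hγ : 0 ≤ γ) (hL : Conducting (lapReg G γ)) (hdiam : ∀ i, InducedDiamLE G {v | cl v = i} Δ)
    {g : ℕ} (hg : 1 ≤ g) (hV : Fintype.card V < 2 ^ g) :
    ∑ e ∈ heavyPairs G (reff (lapReg G γ)) (64 * (8 * g ^ 2 + 1) ^ 2 * Δ),
      reff (lapReg G γ) e.1 e.2 ≤ 256 * (8 * g ^ 2 + 1) ^ 2 * Fintype.card κ * (3 * g) := by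
  classical
  set R := reff (lapReg G γ) with hR
  -- With `L = 8g² + 1` this is `(8L)² Δ`: a potential of energy at most `1 / θ₀` then varies by at
  -- most `1 / (8L)` on a cluster.
  set θ₀ : ℝ := 64 * (8 * g ^ 2 + 1) ^ 2 * Δ with hθ₀
  set J := heavyPairs G R θ₀ with hJdef
  have hg1 : (1 : ℝ) ≤ g := by exact_mod_cast hg
  have hθ₀0 : 0 < θ₀ := by positivity
  have hJ : ∀ e ∈ J, G.Adj e.1 e.2 ∧ θ₀ ≤ R e.1 e.2 := fun e he => (Finset.mem_filter.1 he).2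
  have hcard : J.card < 2 ^ (2 * g) := by
    have h1 : J.card ≤ Fintype.card V * Fintype.card V := by
      rw [← Fintype.card_prod]
      exact Finset.card_le_univ J
    refine lt_of_le_of_lt h1 ?_
    rw [two_mul, pow_add]
    exact Nat.mul_lt_mul'' hV hV
  have hD := lapReg_isDirichlet G hγ
  have hsum := sum_le_mul_harmonic (fun e : V × V => R e.1 e.2)
    (N := 256 * (8 * g ^ 2 + 1) ^ 2 * Fintype.card κ) J.card J rfl
    (fun e he => hθ₀0.le.trans (hJ e he).2) (fun e he => by
      have hθ : θ₀ ≤ R e.1 e.2 := (hJ e he).2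
      have hθ0 : 0 < R e.1 e.2 := hθ₀0.trans_le hθ
      rw [← le_div_iff₀ hθ0]
      refine card_le_of_potential G cl _ (fun e' he' => (hJ e' (Finset.mem_filter.1 he').1).1) hθ0
        hg (lt_of_le_of_lt (Finset.card_filter_le _ _) hcard) fun e' he' => ?_
      have hle : R e.1 e.2 ≤ R e'.1 e'.2 := (Finset.mem_filter.1 he').2
      have hR0 : 0 < R e'.1 e'.2 := hθ0.trans_le hle
      obtain ⟨ψ, -, h1, h2⟩ := exists_potential hD.herm (hL e'.1 e'.2)
      rw [← hR] at h1 h2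
      -- Rescaled to unit drop, the potential has energy equal to the inverse of the resistance.
      set x : V → ℝ := (R e'.1 e'.2)⁻¹ • ψ with hx
      have hform : x ⬝ᵥ (lapReg G γ).mulVec x = (R e'.1 e'.2)⁻¹ := by
        rw [hx, Matrix.mulVec_smul, smul_dotProduct, dotProduct_smul, h2]
        simp only [smul_eq_mul]
        field_simp
      have hE : dartEnergy G x / 2 ≤ (R e.1 e.2)⁻¹ :=
        (dartEnergy_le_lapReg_form G hγ x).trans (hform.le.trans (inv_anti₀ hθ0 hle))
      refine ⟨x, ?_, ?_, ?_⟩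
      · simp only [hx, Pi.smul_apply, smul_eq_mul]
        rw [← mul_sub, h1, inv_mul_cancel₀ hR0.ne']
      · rw [div_eq_mul_inv]
        linarith
      · intro p q hpq
        have h3 := (hdiam (cl q)).sq_sub_le hΔ.le (u := p) (v := q) hpq rfl x
        apply abs_le_of_sq_le_sq _ (by positivity)
        refine h3.trans ((mul_le_mul_of_nonneg_left hE hΔ.le).trans ?_)
        rw [← div_eq_mul_inv, div_le_iff₀ hθ0]
        calc Δ = (1 / (8 * ((8 * g ^ 2 + 1 : ℕ) : ℝ))) ^ 2 * θ₀ := by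
              rw [hθ₀]
              push_cast
              field_simp
              norm_num
          _ ≤ _ := mul_le_mul_of_nonneg_left hθ (by positivity))
  refine hsum.trans (mul_le_mul_of_nonneg_left ?_ (by positivity))
  refine (harmonic_le_one_add_log _).trans ?_
  have hlog : Real.log J.card ≤ 2 * g := by
    rcases Nat.eq_zero_or_pos J.card with h0 | h0
    · rw [h0]
      simp
    · have h1 : Real.log J.card ≤ Real.log (2 ^ (2 * g)) :=
        Real.log_le_log (by exact_mod_cast h0) (by exact_mod_cast hcard.le)
      rw [Real.log_pow] at h1
      push_cast at h1
      have h2 : Real.log 2 ≤ 1 := by linarith [Real.log_two_lt_d9]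
      nlinarith
  linarith

end Clusters

/-! ### Counting disjoint balls -/

/-- Few multiples of `θ` lie in a short interval. -/
lemma card_le_of_mul_mem_Icc (s : Finset ℕ) {a b θ : ℝ} (hθ : 0 < θ) (hab : a ≤ b)
    (hs : ∀ j ∈ s, a ≤ j * θ ∧ j * θ ≤ b) : (s.card : ℝ) ≤ (b - a) / θ + 1 := by
  rcases s.eq_empty_or_nonempty with rfl | hne
  · have : 0 ≤ (b - a) / θ := div_nonneg (by linarith) hθ.le
    simp only [Finset.card_empty, Nat.cast_zero]
    linarith
  · have h1 : s ⊆ Finset.Icc (s.min' hne) (s.max' hne) := fun j hj =>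
      Finset.mem_Icc.2 ⟨s.min'_le j hj, s.le_max' j hj⟩
    have h2 := Finset.card_le_card h1
    rw [Nat.card_Icc] at h2
    have h3 := hs _ (s.min'_mem hne)
    have h4 := hs _ (s.max'_mem hne)
    have h5 : s.min' hne ≤ s.max' hne := s.min'_le _ (s.max'_mem hne)
    have h6 : (s.card : ℝ) + s.min' hne ≤ s.max' hne + 1 := by
      have : s.card + s.min' hne ≤ s.max' hne + 1 := by omega
      exact_mod_cast this
    have h7 : ((s.max' hne : ℝ) - s.min' hne) ≤ (b - a) / θ := by
      rw [le_div_iff₀ hθ]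
      linarith
    linarith

section Balls

variable {V κ : Type*} [Fintype V] [DecidableEq V] [DecidableEq κ] [Fintype κ]

open Classical in
/-- The clusters that meet the ball of radius `ρ` around `u`. -/
def clustersNear (R : V → V → ℝ) (cl : V → κ) (ρ : ℝ) (u : V) : Finset κ :=
  Finset.univ.filter fun C => ∃ w, cl w = C ∧ R u w ≤ ρ

open Classical in
/-- A ball that meets few clusters and whose centre is well connected to the outside contains
the ends of edges of large total resistance. -/
lemma le_sum_heavyPairs_of_ball (G : SimpleGraph V) (R : V → V → ℝ) (hself : ∀ u, R u u = 0)
    (htri : ∀ u v w, R u w ≤ R u v + R v w) (hcomm : ∀ u v, R u v = R v u)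
    (cl : V → κ) {Δ θ ρ d : ℝ} (hcl : ∀ u v, cl u = cl v → R u v ≤ Δ) (hΔθ : Δ ≤ θ) (hθ : 0 < θ)
    (hd : 0 ≤ d) {u v : V} (hv : ρ < R u v)
    (hconn : ∀ S : Finset V, u ∈ S → v ∉ S → d ≤ (G.interedges S Sᶜ).card)
    (hfew : 20 * ((clustersNear R cl (2 * ρ) u).card : ℝ) < ρ / θ) (hρ : 0 < ρ) :
    d * ρ / 8 ≤ ∑ e ∈ (heavyPairs G R θ).filter (fun e => R u e.1 ≤ ρ), R e.1 e.2 := by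
  set J := (heavyPairs G R θ).filter (fun e => R u e.1 ≤ ρ) with hJ
  set m := (clustersNear R cl (2 * ρ) u).card with hm
  set N := ⌊ρ / θ⌋₊ with hN
  have hm1 : 1 ≤ m := Finset.card_pos.2
    ⟨cl u, Finset.mem_filter.2 ⟨Finset.mem_univ _, u, rfl, by rw [hself]; linarith⟩⟩
  have hN1 : ρ / θ < N + 1 := Nat.lt_floor_add_one _
  have hN2 : (N : ℝ) ≤ ρ / θ := Nat.floor_le (by positivity)
  have hNm : 20 * m ≤ N := by
    have : (20 * m : ℝ) < N + 1 := hfew.trans hN1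
    have : 20 * m < N + 1 := by exact_mod_cast this
    omega
  have hNθ : (N : ℝ) * θ ≤ ρ := by rwa [le_div_iff₀ hθ] at hN2
  have hNρ : ρ ≤ 2 * (N * θ) := by
    rw [div_lt_iff₀ hθ] at hN1
    have : (1 : ℝ) ≤ N := by exact_mod_cast (by omega : 1 ≤ N)
    nlinarith
  have hθρ : θ ≤ ρ := by
    have : (1 : ℝ) ≤ N := by exact_mod_cast (by omega : 1 ≤ N)
    nlinarith
  have hsymm : ∀ p q, R u q - R u p ≤ R p q := fun p q => by linarith [htri u p q]
  -- A radius is good if no vertex lies within `θ` of its sphere; every edge crossing the sphere is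
  -- then heavy.
  set good := (Finset.Icc 1 N).filter fun j : ℕ => ∀ w, θ < |R u w - j * θ| with hgood
  set bad := (Finset.Icc 1 N).filter fun j : ℕ => ¬ ∀ w, θ < |R u w - j * θ| with hbad
  have hjN : ∀ j ∈ Finset.Icc 1 N, (j : ℝ) * θ ≤ ρ := fun j hj => by
    have : (j : ℝ) ≤ N := by exact_mod_cast (Finset.mem_Icc.1 hj).2
    nlinarith
  -- All vertices of a cluster are within `Δ ≤ θ` of one of them, so a cluster spoils only radii in
  -- an interval of length `4θ`, which contains at most five multiples of `θ`.
  have hbadcard : bad.card ≤ 5 * m := by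
    have hsub : bad ⊆ (clustersNear R cl (2 * ρ) u).biUnion fun C =>
        (Finset.Icc 1 N).filter fun j : ℕ => ∃ w, cl w = C ∧ |R u w - j * θ| ≤ θ := by
      intro j hj
      obtain ⟨hj1, hj2⟩ := Finset.mem_filter.1 hj
      push Not at hj2
      obtain ⟨w, hw⟩ := hj2
      refine Finset.mem_biUnion.2 ⟨cl w, Finset.mem_filter.2 ⟨Finset.mem_univ _, w, rfl, ?_⟩,
        Finset.mem_filter.2 ⟨hj1, w, rfl, hw⟩⟩
      have := (abs_le.1 hw).2
      linarith [hjN j hj1]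
    refine (Finset.card_le_card hsub).trans ?_
    refine (Finset.card_biUnion_le_card_mul _ _ 5 fun C hC => ?_).trans_eq (mul_comm _ _)
    obtain ⟨w₀, hw₀, -⟩ := (Finset.mem_filter.1 hC).2
    have := card_le_of_mul_mem_Icc
      ((Finset.Icc 1 N).filter fun j : ℕ => ∃ w, cl w = C ∧ |R u w - j * θ| ≤ θ)
      (a := R u w₀ - 2 * θ) (b := R u w₀ + 2 * θ) hθ (by linarith) fun j hj => by
        obtain ⟨w, hw, hw'⟩ := (Finset.mem_filter.1 hj).2
        have h1 := abs_le.1 hw'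
        have h2 := hcl w w₀ (hw.trans hw₀.symm)
        have h3 := hsymm w w₀
        have h4 := hsymm w₀ w
        rw [hcomm w₀ w] at h4
        constructor <;> linarith
    rw [show (R u w₀ + 2 * θ - (R u w₀ - 2 * θ)) / θ + 1 = 5 by field_simp; ring] at this
    exact_mod_cast this
  have hgoodcard : (N : ℝ) ≤ 2 * good.card := by
    have h1 : good.card + bad.card = N := by
      rw [hgood, hbad, Finset.card_filter_add_card_filter_not, Nat.card_Icc]
      omega
    have : N ≤ 2 * good.card := by omega
    exact_mod_cast this
  have hcross : ∀ j ∈ good, d ≤ ((J.filter fun e => R u e.1 ≤ j * θ ∧ j * θ ≤ R u e.2).card : ℝ) := by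
    intro j hj
    obtain ⟨hj1, hj2⟩ := Finset.mem_filter.1 hj
    refine (hconn (Finset.univ.filter fun w => R u w ≤ j * θ) ?_ ?_).trans ?_
    · simp only [Finset.mem_filter, Finset.mem_univ, true_and, hself]
      positivity
    · simp only [Finset.mem_filter, Finset.mem_univ, true_and, not_le]
      exact (hjN j hj1).trans_lt hv
    · have : G.interedges (Finset.univ.filter fun w => R u w ≤ j * θ)
          (Finset.univ.filter fun w => R u w ≤ j * θ)ᶜ ⊆
          J.filter fun e => R u e.1 ≤ j * θ ∧ j * θ ≤ R u e.2 := by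
        intro e he
        rw [SimpleGraph.mem_interedges_iff] at he
        obtain ⟨h1, h2, hadj⟩ := he
        simp only [Finset.mem_compl, Finset.mem_filter, Finset.mem_univ, true_and, not_le] at h1 h2
        have h3 := hj2 e.1
        have h4 := hj2 e.2
        rw [abs_of_nonpos (by linarith)] at h3
        rw [abs_of_pos (by linarith)] at h4
        have h5 := hsymm e.1 e.2
        simp only [hJ, heavyPairs, Finset.mem_filter, Finset.mem_univ, true_and]
        exact ⟨⟨⟨hadj, by linarith⟩, h1.trans (hjN j hj1)⟩, h1, h2.le⟩
      exact_mod_cast Finset.card_le_card this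
  have hdouble : ∑ j ∈ good, ((J.filter fun e => R u e.1 ≤ j * θ ∧ j * θ ≤ R u e.2).card : ℝ) =
      ∑ e ∈ J, ((good.filter fun j : ℕ => R u e.1 ≤ j * θ ∧ j * θ ≤ R u e.2).card : ℝ) := by
    have := Finset.sum_card_bipartiteAbove_eq_sum_card_bipartiteBelow (s := good) (t := J)
      fun (j : ℕ) (e : V × V) => R u e.1 ≤ j * θ ∧ j * θ ≤ R u e.2
    simp only [Finset.bipartiteAbove, Finset.bipartiteBelow] at this
    exact_mod_cast this
  -- By the triangle inequality an edge crosses at most `R / θ + 1` spheres, and heaviness absorbs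
  -- the `1`.
  have hupper : ∀ e ∈ J, ((good.filter fun j : ℕ => R u e.1 ≤ j * θ ∧ j * θ ≤ R u e.2).card : ℝ) ≤
      2 / θ * R e.1 e.2 := by
    intro e he
    have hRe : θ ≤ R e.1 e.2 := (Finset.mem_filter.1 (Finset.mem_filter.1 he).1).2.2
    have hone : 1 ≤ R e.1 e.2 / θ := by rwa [one_le_div hθ]
    have heq : 2 / θ * R e.1 e.2 = R e.1 e.2 / θ + R e.1 e.2 / θ := by ring
    rw [heq]
    by_cases hab : R u e.1 ≤ R u e.2
    · have h1 := card_le_of_mul_mem_Icc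
        (good.filter fun j : ℕ => R u e.1 ≤ j * θ ∧ j * θ ≤ R u e.2) hθ hab
        fun j hj => (Finset.mem_filter.1 hj).2
      have h2 : (R u e.2 - R u e.1) / θ ≤ R e.1 e.2 / θ :=
        div_le_div_of_nonneg_right (hsymm _ _) hθ.le
      linarith
    · rw [Finset.filter_false_of_mem fun j _ hj => hab (hj.1.trans hj.2)]
      simp only [Finset.card_empty, Nat.cast_zero]
      linarith
  have h1 : good.card * d ≤ 2 / θ * ∑ e ∈ J, R e.1 e.2 := by
    calc good.card * d = ∑ j ∈ good, d := by simp
      _ ≤ _ := Finset.sum_le_sum hcross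
      _ = _ := hdouble
      _ ≤ _ := by rw [Finset.mul_sum]; exact Finset.sum_le_sum hupper
  have h2 : good.card * d * θ ≤ 2 * ∑ e ∈ J, R e.1 e.2 := by
    have := mul_le_mul_of_nonneg_right h1 hθ.le
    rwa [mul_right_comm (2 / θ), div_mul_cancel₀ _ hθ.ne'] at this
  have h3 : N * (d * θ) ≤ 2 * good.card * (d * θ) :=
    mul_le_mul_of_nonneg_right hgoodcard (by positivity)
  nlinarith [mul_le_mul_of_nonneg_left hNρ hd]

open Classical in
/-- The number of well connected centres that are far apart. -/
lemma card_centres_le (G : SimpleGraph V) (R : V → V → ℝ) (hself : ∀ u, R u u = 0)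
    (htri : ∀ u v w, R u w ≤ R u v + R v w) (hcomm : ∀ u v, R u v = R v u)
    (cl : V → κ) {Δ θ ρ d X : ℝ} (hcl : ∀ u v, cl u = cl v → R u v ≤ Δ) (hΔθ : Δ ≤ θ)
    (hθ : 0 < θ) (hΔρ : Δ ≤ 4 * ρ) (hρ : 0 < ρ) (hd : 0 < d)
    (hX : ∑ e ∈ heavyPairs G R θ, R e.1 e.2 ≤ X) (U : Finset V)
    (hU : ∀ u ∈ U, ∀ u' ∈ U, u ≠ u' → 8 * ρ < R u u')
    (hconn : ∀ u ∈ U, ∃ v, ρ < R u v ∧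
      ∀ S : Finset V, u ∈ S → v ∉ S → d ≤ (G.interedges S Sᶜ).card) :
    (U.card : ℝ) ≤ 20 * Fintype.card κ * θ / ρ + 8 * X / (d * ρ) := by
  -- Centres with few nearby clusters are charged to the heavy edges in their disjoint `ρ`-balls.
  -- The others are charged to their nearby clusters, which are not shared: two `2ρ`-balls meeting
  -- one cluster would have centres at distance at most `4ρ + Δ ≤ 8ρ`.
  set few : V → Prop := fun u => 20 * ((clustersNear R cl (2 * ρ) u).card : ℝ) < ρ / θ with hfew
  have h1 : ((U.filter few).card : ℝ) ≤ 8 * X / (d * ρ) := by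
    have hlow : ∑ u ∈ U.filter few, d * ρ / 8 ≤ ∑ u ∈ U.filter few,
        ∑ e ∈ (heavyPairs G R θ).filter (fun e => R u e.1 ≤ ρ), R e.1 e.2 := by
      refine Finset.sum_le_sum fun u hu => ?_
      obtain ⟨huU, hu⟩ := Finset.mem_filter.1 hu
      obtain ⟨v, hv, hS⟩ := hconn u huU
      exact le_sum_heavyPairs_of_ball G R hself htri hcomm cl hcl hΔθ hθ hd.le hv hS hu hρ
    rw [← Finset.sum_biUnion] at hlow
    · have hle : ∑ e ∈ (U.filter few).biUnion
          (fun u => (heavyPairs G R θ).filter (fun e => R u e.1 ≤ ρ)), R e.1 e.2 ≤ X := by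
        refine le_trans (Finset.sum_le_sum_of_subset_of_nonneg ?_ fun e he _ => ?_) hX
        · intro e he
          obtain ⟨u, -, hu⟩ := Finset.mem_biUnion.1 he
          exact (Finset.mem_filter.1 hu).1
        · exact hθ.le.trans (Finset.mem_filter.1 he).2.2
      have := hlow.trans hle
      rw [Finset.sum_const, nsmul_eq_mul] at this
      rw [le_div_iff₀ (by positivity)]
      linarith
    · intro u hu u' hu' hne
      rw [Function.onFun, Finset.disjoint_left]
      intro e he he'
      have h3 := hU u (Finset.mem_filter.1 hu).1 u' (Finset.mem_filter.1 hu').1 hne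
      have h4 := (Finset.mem_filter.1 he).2
      have h5 := (Finset.mem_filter.1 he').2
      have h6 := htri u e.1 u'
      rw [hcomm e.1 u'] at h6
      linarith
  have h2 : ((U.filter fun u => ¬ few u).card : ℝ) ≤ 20 * Fintype.card κ * θ / ρ := by
    have hle : ∑ u ∈ U.filter (fun u => ¬ few u), (clustersNear R cl (2 * ρ) u).card ≤
        Fintype.card κ := by
      rw [← Finset.card_biUnion]
      · exact Finset.card_le_univ _
      · intro u hu u' hu' hne
        rw [Function.onFun, Finset.disjoint_left]
        intro C hC hC'
        obtain ⟨w, hw, hwR⟩ := (Finset.mem_filter.1 hC).2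
        obtain ⟨w', hw', hwR'⟩ := (Finset.mem_filter.1 hC').2
        have h3 := hU u (Finset.mem_filter.1 hu).1 u' (Finset.mem_filter.1 hu').1 hne
        have h4 := htri u w u'
        have h5 := htri w w' u'
        have h6 := hcl w w' (hw.trans hw'.symm)
        rw [hcomm w' u'] at h5
        linarith
    have hlow : ∑ u ∈ U.filter (fun u => ¬ few u), ρ / θ ≤
        ∑ u ∈ U.filter (fun u => ¬ few u), 20 * ((clustersNear R cl (2 * ρ) u).card : ℝ) :=
      Finset.sum_le_sum fun u hu => not_lt.1 (Finset.mem_filter.1 hu).2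
    rw [← Finset.mul_sum, Finset.sum_const, nsmul_eq_mul] at hlow
    have hle' : ∑ u ∈ U.filter (fun u => ¬ few u), ((clustersNear R cl (2 * ρ) u).card : ℝ) ≤
        Fintype.card κ := by exact_mod_cast hle
    have h3 := hlow.trans (mul_le_mul_of_nonneg_left hle' (by norm_num : (0 : ℝ) ≤ 20))
    rw [le_div_iff₀ hρ]
    rw [← mul_div_assoc, div_le_iff₀ hθ] at h3
    exact h3
  have h3 := Finset.card_filter_add_card_filter_not (s := U) few
  have h4 : (U.card : ℝ) = (U.filter few).card + (U.filter fun u => ¬ few u).card := by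
    exact_mod_cast h3.symm
  linarith

end Balls

/-! ### Random signs -/

section Signs

variable {ι : Type*} [Fintype ι] [DecidableEq ι]

/-- The sum of the entries of `y` with signs `σ`. -/
def signedSum (y : ι → ℝ) (σ : ι → Bool) : ℝ := ∑ e, sgn (σ e) * y e

lemma signedSum_smul (c : ℝ) (y : ι → ℝ) (σ : ι → Bool) :
    signedSum (c • y) σ = c * signedSum y σ := by
  simp only [signedSum, Pi.smul_apply, smul_eq_mul, Finset.mul_sum]
  exact Finset.sum_congr rfl fun e _ => by ring

/-- Independence turns the sum into a product of hyperbolic cosines, each bounded by `cosh x ≤ exp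
(x² / 2)`. -/
lemma sum_exp_mul_signedSum_le (y : ι → ℝ) (t : ℝ) :
    ∑ σ : ι → Bool, Real.exp (t * signedSum y σ) ≤
      2 ^ Fintype.card ι * Real.exp (t ^ 2 * (∑ e, y e ^ 2) / 2) := by
  have h1 : ∀ σ : ι → Bool, Real.exp (t * signedSum y σ) =
      ∏ e, Real.exp (t * (sgn (σ e) * y e)) := by
    intro σ
    rw [signedSum, Finset.mul_sum, Real.exp_sum]
  have h2 : ∑ σ : ι → Bool, ∏ e, Real.exp (t * (sgn (σ e) * y e)) =
      ∏ e, ∑ b : Bool, Real.exp (t * (sgn b * y e)) := by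
    rw [Finset.prod_univ_sum, Fintype.piFinset_univ]
  simp_rw [h1]
  rw [h2]
  have h3 : ∀ e, ∑ b : Bool, Real.exp (t * (sgn b * y e)) ≤ 2 * Real.exp ((t * y e) ^ 2 / 2) := by
    intro e
    have := Real.cosh_le_exp_half_sq (t * y e)
    rw [Real.cosh_eq] at this
    simp only [Fintype.sum_bool, sgn, if_true, one_mul, Bool.false_eq_true, if_false, neg_mul,
      mul_neg]
    linarith
  calc ∏ e, ∑ b : Bool, Real.exp (t * (sgn b * y e))
      ≤ ∏ e, (2 * Real.exp ((t * y e) ^ 2 / 2)) :=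
        Finset.prod_le_prod (fun e _ => Finset.sum_nonneg fun b _ => (Real.exp_pos _).le)
          fun e _ => h3 e
    _ = _ := by
        rw [Finset.prod_mul_distrib, ← Real.exp_sum, Finset.prod_const, Finset.card_univ]
        congr 2
        rw [Finset.mul_sum, Finset.sum_div]
        exact Finset.sum_congr rfl fun e _ => by ring

lemma sum_sgn_mul_sgn (e f : ι) :
    ∑ σ : ι → Bool, sgn (σ e) * sgn (σ f) = if e = f then (2 : ℝ) ^ Fintype.card ι else 0 := by
  split_ifs with h
  · subst h
    have : ∀ b : Bool, sgn b * sgn b = 1 := by intro b; cases b <;> simp [sgn]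
    simp [this]
  · let flip : (ι → Bool) ≃ (ι → Bool) :=
      Function.Involutive.toPerm (fun σ => Function.update σ e (!σ e)) fun σ => by simp
    have h1 : ∑ σ : ι → Bool, sgn (σ e) * sgn (σ f) =
        ∑ σ : ι → Bool, sgn (flip σ e) * sgn (flip σ f) :=
      (Equiv.sum_comp flip fun σ => sgn (σ e) * sgn (σ f)).symm
    have h2 : ∀ σ, sgn (flip σ e) * sgn (flip σ f) = -(sgn (σ e) * sgn (σ f)) := by
      intro σ
      have e1 : flip σ e = !σ e := Function.update_self _ _ _
      have e2 : flip σ f = σ f := Function.update_of_ne (Ne.symm h) _ _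
      have hneg : ∀ b : Bool, sgn (!b) = -sgn b := by intro b; cases b <;> simp [sgn]
      rw [e1, e2, hneg, neg_mul]
    simp_rw [h2, Finset.sum_neg_distrib] at h1
    linarith

lemma sum_signedSum_sq (y : ι → ℝ) :
    ∑ σ : ι → Bool, signedSum y σ ^ 2 = 2 ^ Fintype.card ι * ∑ e, y e ^ 2 := by
  have h1 : ∀ σ : ι → Bool, signedSum y σ ^ 2 =
      ∑ e, ∑ f, (y e * y f) * (sgn (σ e) * sgn (σ f)) := by
    intro σ
    rw [sq, signedSum, Finset.sum_mul_sum]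
    exact Finset.sum_congr rfl fun e _ => Finset.sum_congr rfl fun f _ => by ring
  simp_rw [h1]
  rw [Finset.sum_comm, Finset.mul_sum]
  refine Finset.sum_congr rfl fun e _ => ?_
  rw [Finset.sum_comm]
  simp_rw [← Finset.mul_sum, sum_sgn_mul_sgn]
  simp
  ring

lemma one_add_sq_add_pow_le_cosh (x : ℝ) : 1 + x ^ 2 / 2 + x ^ 4 / 24 ≤ Real.cosh x := by
  have h := sum_le_hasSum (Finset.range 3) (fun i _ => by
    rw [pow_mul]; positivity) (Real.hasSum_cosh x)
  simpa [Finset.sum_range_succ, Nat.factorial] using h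

/-- Averaging the Taylor bound for `cosh`, with mean of `cosh` at most `exp (1/2)` and second moment
`1`, leaves a fourth moment of at most `24 (1.6488 - 1.5) < 3.6`. -/
lemma sum_signedSum_pow_four_le {y : ι → ℝ} (hy : ∑ e, y e ^ 2 = 1) :
    ∑ σ : ι → Bool, signedSum y σ ^ 4 ≤ 2 ^ Fintype.card ι * (3.6 : ℝ) := by
  have h1 := sum_exp_mul_signedSum_le y 1
  have h2 := sum_exp_mul_signedSum_le y (-1)
  rw [hy] at h1 h2
  have h3 : ∑ σ : ι → Bool, (1 + signedSum y σ ^ 2 / 2 + signedSum y σ ^ 4 / 24) ≤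
      ∑ σ : ι → Bool, (Real.exp (1 * signedSum y σ) + Real.exp (-1 * signedSum y σ)) / 2 := by
    refine Finset.sum_le_sum fun σ _ => ?_
    have := one_add_sq_add_pow_le_cosh (signedSum y σ)
    rw [Real.cosh_eq] at this
    simpa using this
  rw [← Finset.sum_div, Finset.sum_add_distrib, Finset.sum_add_distrib, Finset.sum_add_distrib,
    ← Finset.sum_div, ← Finset.sum_div, sum_signedSum_sq, hy] at h3
  simp only [Finset.sum_const, Finset.card_univ, Fintype.card_pi, Fintype.card_bool,
    Finset.prod_const, nsmul_eq_mul, Nat.cast_pow, Nat.cast_ofNat, mul_one] at h3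
  have h4 : Real.exp (1 / 2) ≤ 1.6488 := by
    have he := Real.exp_one_lt_d9
    have hsq : Real.exp (1 / 2) ^ 2 = Real.exp 1 := by rw [← Real.exp_nat_mul]; norm_num
    by_contra hc
    push Not at hc
    nlinarith
  norm_num at h1 h2
  norm_num at h4
  have hpos : (0 : ℝ) < 2 ^ Fintype.card ι := by positivity
  have h5 := mul_le_mul_of_nonneg_left h4 hpos.le
  norm_num at h3 ⊢
  linarith

lemma exp_neg_le_quadratic {z : ℝ} (hz : 0 ≤ z) : Real.exp (-z) ≤ 1 - z + z ^ 2 / 2 := by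
  have h1 := Real.quadratic_le_exp_of_nonneg hz
  have h2 : (0 : ℝ) ≤ 1 - z + z ^ 2 / 2 := by nlinarith [sq_nonneg (z - 1)]
  -- The product of `1 - z + z² / 2` and `1 + z + z² / 2` is `1 + z⁴ / 4`.
  have h3 : 1 ≤ (1 - z + z ^ 2 / 2) * Real.exp z := by
    refine le_trans ?_ (mul_le_mul_of_nonneg_left h1 h2)
    nlinarith [sq_nonneg (z ^ 2)]
  rw [Real.exp_neg, inv_le_iff_one_le_mul₀ (Real.exp_pos z)]
  exact h3

/-- Lower tail: the quadratic bound for `exp (-z)` and the second and fourth moments give a mean of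
at most `1 - 1/20 + 3.6/800 = 0.9545`, below `exp (-0.041)`. -/
lemma sum_exp_neg_signedSum_sq_le {y : ι → ℝ} (hy : ∑ e, y e ^ 2 = 1) :
    ∑ σ : ι → Bool, Real.exp (-(1 / 20) * signedSum y σ ^ 2) ≤
      2 ^ Fintype.card ι * Real.exp (-(1 / 20) * (4 / 5) - 1 / 1000) := by
  have h1 : ∑ σ : ι → Bool, Real.exp (-(1 / 20) * signedSum y σ ^ 2) ≤
      ∑ σ : ι → Bool, (1 - 1 / 20 * signedSum y σ ^ 2 + 1 / 800 * signedSum y σ ^ 4) := by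
    refine Finset.sum_le_sum fun σ _ => ?_
    have := exp_neg_le_quadratic (z := 1 / 20 * signedSum y σ ^ 2) (by positivity)
    rw [neg_mul]
    refine this.trans (le_of_eq (by ring))
  rw [Finset.sum_add_distrib, Finset.sum_sub_distrib, ← Finset.mul_sum, ← Finset.mul_sum,
    sum_signedSum_sq, hy] at h1
  simp only [Finset.sum_const, Finset.card_univ, Fintype.card_pi, Fintype.card_bool,
    Finset.prod_const, nsmul_eq_mul, Nat.cast_pow, Nat.cast_ofNat, mul_one] at h1
  have h2 := sum_signedSum_pow_four_le hy
  have hpos : (0 : ℝ) < 2 ^ Fintype.card ι := by positivity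
  have h3 : (0.9545 : ℝ) ≤ Real.exp (-(1 / 20) * (4 / 5) - 1 / 1000) := by
    have := Real.add_one_le_exp (-(1 / 20 : ℝ) * (4 / 5) - 1 / 1000)
    norm_num at this ⊢
    linarith
  have h4 := mul_le_mul_of_nonneg_left h3 hpos.le
  have h5 : (2 : ℝ) ^ Fintype.card ι - 1 / 20 * 2 ^ Fintype.card ι +
      1 / 800 * ∑ σ : ι → Bool, signedSum y σ ^ 4 ≤ 2 ^ Fintype.card ι * 0.9545 := by
    norm_num at h2 ⊢
    linarith
  exact h1.trans (h5.trans h4)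

open MeasureTheory in
lemma integral_exp_mul_sub_half_sq (c : ℝ) :
    Integrable (fun g : ℝ => Real.exp (c * g) * Real.exp (-(1 / 2) * g ^ 2)) ∧
    ∫ g : ℝ, Real.exp (c * g) * Real.exp (-(1 / 2) * g ^ 2) =
      Real.exp (c ^ 2 / 2) * Real.sqrt (Real.pi / (1 / 2)) := by
  have h : (fun g : ℝ => Real.exp (c * g) * Real.exp (-(1 / 2) * g ^ 2)) =
      fun g => Real.exp (c ^ 2 / 2) * Real.exp (-(1 / 2) * (g - c) ^ 2) := by
    funext g
    rw [← Real.exp_add, ← Real.exp_add]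
    congr 1
    ring
  rw [h]
  constructor
  · exact ((integrable_exp_neg_mul_sq (by norm_num : (0 : ℝ) < 1 / 2)).comp_sub_right c).const_mul _
  · rw [integral_const_mul, integral_sub_right_eq_self (fun g => Real.exp (-(1 / 2) * g ^ 2)) c,
      integral_gaussian]

-- Upper tail, by Gaussian linearisation: `exp (s² / 20)` is the mean of `exp (t s g)` over a
-- standard Gaussian `g` with `t² = 1/10`. The moment generating function of the signed sum reduces
-- the mean to that of `exp (g² / 20)`, which is `√(10/9) ≤ exp 0.059`.
open MeasureTheory in
lemma sum_exp_signedSum_sq_le {y : ι → ℝ} (hy : ∑ e, y e ^ 2 = 1) :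
    ∑ σ : ι → Bool, Real.exp (1 / 20 * signedSum y σ ^ 2) ≤
      2 ^ Fintype.card ι * Real.exp (1 / 20 * (6 / 5) - 1 / 1000) := by
  set t : ℝ := Real.sqrt (1 / 10) with ht
  have ht2 : t ^ 2 = 1 / 10 := Real.sq_sqrt (by norm_num)
  have hint : ∀ σ : ι → Bool, Integrable (fun g : ℝ =>
      Real.exp (t * signedSum y σ * g) * Real.exp (-(1 / 2) * g ^ 2)) :=
    fun σ => (integral_exp_mul_sub_half_sq _).1
  have h1 : (∑ σ : ι → Bool, Real.exp (1 / 20 * signedSum y σ ^ 2)) * Real.sqrt (Real.pi / (1 / 2)) =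
      ∫ g : ℝ, ∑ σ : ι → Bool,
        Real.exp (t * signedSum y σ * g) * Real.exp (-(1 / 2) * g ^ 2) := by
    rw [integral_finsetSum _ fun σ _ => hint σ, Finset.sum_mul]
    refine Finset.sum_congr rfl fun σ _ => ?_
    rw [(integral_exp_mul_sub_half_sq _).2, mul_pow, ht2]
    congr 2
    ring
  have h2 : ∫ g : ℝ, ∑ σ : ι → Bool,
        Real.exp (t * signedSum y σ * g) * Real.exp (-(1 / 2) * g ^ 2) ≤
      ∫ g : ℝ, 2 ^ Fintype.card ι * Real.exp (-(9 / 20) * g ^ 2) := by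
    refine integral_mono (integrable_finsetSum _ fun σ _ => hint σ)
      ((integrable_exp_neg_mul_sq (by norm_num)).const_mul _) fun g => ?_
    simp only
    rw [← Finset.sum_mul]
    have := sum_exp_mul_signedSum_le y (t * g)
    rw [hy, mul_pow, ht2] at this
    have h3 : ∑ σ : ι → Bool, Real.exp (t * signedSum y σ * g) =
        ∑ σ : ι → Bool, Real.exp (t * g * signedSum y σ) :=
      Finset.sum_congr rfl fun σ _ => by rw [mul_right_comm]
    rw [h3]
    refine (mul_le_mul_of_nonneg_right this (Real.exp_pos _).le).trans (le_of_eq ?_)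
    rw [mul_assoc, ← Real.exp_add]
    congr 2
    ring
  rw [integral_const_mul, integral_gaussian, ← h1] at h2
  have hs : Real.sqrt (Real.pi / (9 / 20)) ≤
      Real.exp (1 / 20 * (6 / 5) - 1 / 1000) * Real.sqrt (Real.pi / (1 / 2)) := by
    have he : Real.sqrt (10 / 9) ≤ Real.exp (1 / 20 * (6 / 5) - 1 / 1000) := by
      rw [Real.sqrt_le_left (Real.exp_pos _).le, ← Real.exp_nat_mul]
      have := Real.quadratic_le_exp_of_nonneg (x := (0.118 : ℝ)) (by norm_num)
      norm_num at this ⊢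
      linarith
    have : Real.pi / (9 / 20) = 10 / 9 * (Real.pi / (1 / 2)) := by ring
    rw [this, Real.sqrt_mul (by norm_num)]
    exact mul_le_mul_of_nonneg_right he (Real.sqrt_nonneg _)
  have hpos : 0 < Real.sqrt (Real.pi / (1 / 2)) := Real.sqrt_pos.2 (by positivity)
  refine le_of_mul_le_mul_right (h2.trans ?_) hpos
  rw [mul_assoc]
  exact mul_le_mul_of_nonneg_left hs (by positivity)

/-- The Chernoff bound for independent copies. -/
lemma card_filter_le_of_sum_exp_le {Ω : Type*} [Fintype Ω] (f : Ω → ℝ) {a δ : ℝ}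
    (h : ∑ ω, Real.exp (f ω) ≤ Fintype.card Ω * Real.exp (a - δ)) (q : ℕ) :
    ((Finset.univ.filter fun Q : Fin q → Ω => a * q ≤ ∑ i, f (Q i)).card : ℝ) ≤
      Real.exp (-δ * q) * Fintype.card (Fin q → Ω) := by
  classical
  have h1 : ∑ Q : Fin q → Ω, Real.exp (∑ i, f (Q i)) = (∑ ω, Real.exp (f ω)) ^ q := by
    simp_rw [Real.exp_sum]
    rw [← Fintype.piFinset_univ, ← Finset.prod_univ_sum (fun _ : Fin q => Finset.univ)
      (fun _ ω => Real.exp (f ω))]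
    simp
  have h2 : ((Finset.univ.filter fun Q : Fin q → Ω => a * q ≤ ∑ i, f (Q i)).card : ℝ) *
      Real.exp (a * q) ≤ ∑ Q : Fin q → Ω, Real.exp (∑ i, f (Q i)) := by
    calc _ = ∑ Q ∈ Finset.univ.filter (fun Q : Fin q → Ω => a * q ≤ ∑ i, f (Q i)),
          Real.exp (a * q) := by simp
      _ ≤ ∑ Q ∈ Finset.univ.filter (fun Q : Fin q → Ω => a * q ≤ ∑ i, f (Q i)),
          Real.exp (∑ i, f (Q i)) :=
          Finset.sum_le_sum fun Q hQ => Real.exp_le_exp.2 (Finset.mem_filter.1 hQ).2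
      _ ≤ _ := Finset.sum_le_sum_of_subset_of_nonneg (Finset.subset_univ _)
          fun Q _ _ => (Real.exp_pos _).le
  rw [h1] at h2
  have h3 := h2.trans (pow_le_pow_left₀ (Finset.sum_nonneg fun ω _ => (Real.exp_pos _).le) h q)
  rw [mul_pow, ← Real.exp_nat_mul] at h3
  have h4 : Real.exp (q * (a - δ)) = Real.exp (-δ * q) * Real.exp (a * q) := by
    rw [← Real.exp_add]
    congr 1
    ring
  rw [h4, ← mul_assoc] at h3
  have h5 := le_of_mul_le_mul_right h3 (Real.exp_pos _)
  rw [Fintype.card_fun, Fintype.card_fin]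
  push_cast
  linarith

/-- A random sign matrix nearly preserves the norm of a fixed vector. -/
lemma card_filter_not_norm_preserving_le (y : ι → ℝ) (q : ℕ) :
    ((Finset.univ.filter fun Q : Fin q → ι → Bool =>
      ¬ (4 / 5 * (∑ e, y e ^ 2) * q ≤ ∑ i, signedSum y (Q i) ^ 2 ∧
        ∑ i, signedSum y (Q i) ^ 2 ≤ 6 / 5 * (∑ e, y e ^ 2) * q)).card : ℝ) ≤
      2 * Real.exp (-(1 / 1000) * q) * Fintype.card (Fin q → ι → Bool) := by
  classical
  set R := ∑ e, y e ^ 2 with hR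
  rcases (Finset.sum_nonneg fun e _ => sq_nonneg (y e) : 0 ≤ R).eq_or_lt with h0 | h0
  · have hy : y = 0 := by
      funext e
      have := (Finset.sum_eq_zero_iff_of_nonneg fun e _ => sq_nonneg (y e)).1 h0.symm e
        (Finset.mem_univ _)
      simpa using this
    rw [Finset.filter_false_of_mem]
    · simp only [Finset.card_empty, Nat.cast_zero]
      positivity
    · intro Q _ hc
      apply hc
      simp [hR, signedSum, hy]
  -- The moment bounds are for unit vectors, so a nonzero `y` is normalised first.
  · set c := (Real.sqrt R)⁻¹ with hc
    have hc2 : c ^ 2 * R = 1 := by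
      rw [hc, inv_pow, Real.sq_sqrt h0.le, inv_mul_cancel₀ h0.ne']
    have hnorm : ∑ e, (c • y) e ^ 2 = 1 := by
      simp only [Pi.smul_apply, smul_eq_mul, mul_pow]
      rw [← Finset.mul_sum, hc2]
    have hscale : ∀ Q : Fin q → ι → Bool, ∑ i, signedSum (c • y) (Q i) ^ 2 =
        c ^ 2 * ∑ i, signedSum y (Q i) ^ 2 := by
      intro Q
      rw [Finset.mul_sum]
      exact Finset.sum_congr rfl fun i _ => by rw [signedSum_smul, mul_pow]
    have hcard : (Fintype.card (ι → Bool) : ℝ) = 2 ^ Fintype.card ι := by simp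
    have hup := card_filter_le_of_sum_exp_le (Ω := ι → Bool) (a := 1 / 20 * (6 / 5)) (δ := 1 / 1000)
      (fun σ => 1 / 20 * signedSum (c • y) σ ^ 2) (by
        rw [hcard]; exact sum_exp_signedSum_sq_le hnorm) q
    have hlo := card_filter_le_of_sum_exp_le (Ω := ι → Bool) (a := -(1 / 20) * (4 / 5))
      (δ := 1 / 1000) (fun σ => -(1 / 20) * signedSum (c • y) σ ^ 2) (by
        rw [hcard]; exact sum_exp_neg_signedSum_sq_le hnorm) q
    simp_rw [← Finset.mul_sum, hscale] at hup hlo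
    have hc0 : 0 < c ^ 2 := by
      have : c ≠ 0 := by rw [hc]; exact inv_ne_zero (Real.sqrt_pos.2 h0).ne'
      positivity
    have hsub : (Finset.univ.filter fun Q : Fin q → ι → Bool =>
      ¬ (4 / 5 * R * q ≤ ∑ i, signedSum y (Q i) ^ 2 ∧
        ∑ i, signedSum y (Q i) ^ 2 ≤ 6 / 5 * R * q)) ⊆
        (Finset.univ.filter fun Q : Fin q → ι → Bool =>
          1 / 20 * (6 / 5) * q ≤ 1 / 20 * (c ^ 2 * ∑ i, signedSum y (Q i) ^ 2)) ∪
        (Finset.univ.filter fun Q : Fin q → ι → Bool =>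
          -(1 / 20) * (4 / 5) * q ≤ -(1 / 20) * (c ^ 2 * ∑ i, signedSum y (Q i) ^ 2)) := by
      intro Q hQ
      have hQ' := (Finset.mem_filter.1 hQ).2
      rw [Finset.mem_union, Finset.mem_filter, Finset.mem_filter]
      by_cases h1 : 4 / 5 * R * q ≤ ∑ i, signedSum y (Q i) ^ 2
      · left
        refine ⟨Finset.mem_univ _, ?_⟩
        have h2 : 6 / 5 * R * q < ∑ i, signedSum y (Q i) ^ 2 := by
          by_contra h3
          exact hQ' ⟨h1, not_lt.1 h3⟩
        have := mul_le_mul_of_nonneg_left h2.le hc0.le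
        have e : c ^ 2 * (6 / 5 * R * q) = 6 / 5 * q := by linear_combination 6 / 5 * q * hc2
        linarith
      · right
        refine ⟨Finset.mem_univ _, ?_⟩
        have := mul_le_mul_of_nonneg_left (not_le.1 h1).le hc0.le
        have e : c ^ 2 * (4 / 5 * R * q) = 4 / 5 * q := by linear_combination 4 / 5 * q * hc2
        linarith
    have h5 := Nat.cast_le (α := ℝ).2 ((Finset.card_le_card hsub).trans (Finset.card_union_le _ _))
    push_cast at h5
    refine h5.trans ((add_le_add hup hlo).trans (le_of_eq ?_))
    ring

end Signs

/-- With high probability a random sign matrix with at least `10⁶ log n` rows nearly preserves the norms of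
`n ^ 2` given vectors. -/
lemma le_uniformOn_of_norm_preserving {ι : Type*} [Fintype ι] {n : ℕ} (hn : 2 ≤ n) {q : ℕ}
    (hq : 10 ^ 6 * Real.log n ≤ q)
    (y : Fin n → Fin n → ι → ℝ) (A : Set (Fin (q) → ι → Bool))
    (hA : ∀ Q : Fin (q) → ι → Bool, (∀ u v,
      4 / 5 * (∑ e, y u v e ^ 2) * q ≤ ∑ i, signedSum (y u v) (Q i) ^ 2 ∧
      ∑ i, signedSum (y u v) (Q i) ^ 2 ≤ 6 / 5 * (∑ e, y u v e ^ 2) * q) → Q ∈ A) :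
    ENNReal.ofReal (1 - 1 / (n : ℝ) ^ 10) ≤ ProbabilityTheory.uniformOn Set.univ A := by
  classical
  set bad : Fin n × Fin n → Finset (Fin q → ι → Bool) := fun p => Finset.univ.filter fun Q =>
    ¬ (4 / 5 * (∑ e, y p.1 p.2 e ^ 2) * q ≤ ∑ i, signedSum (y p.1 p.2) (Q i) ^ 2 ∧
      ∑ i, signedSum (y p.1 p.2) (Q i) ^ 2 ≤ 6 / 5 * (∑ e, y p.1 p.2 e ^ 2) * q) with hbad
  set B := Finset.univ.biUnion bad with hB
  set T : ℝ := (Fintype.card (Fin q → ι → Bool) : ℝ) with hT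
  have hT0 : 0 < T := by
    rw [hT]
    exact_mod_cast Fintype.card_pos
  have hn2 : (2 : ℝ) ≤ n := by exact_mod_cast hn
  -- The number of rows would allow exponent `1000`; `13` suffices, since `n² · 2 n⁻¹³ ≤ n⁻¹⁰` for
  -- `n ≥ 2`.
  have hexp : Real.exp (-(1 / 1000) * q) ≤ ((n : ℝ) ^ 13)⁻¹ := by
    have h1 := hq
    have hl : 0 ≤ Real.log n := Real.log_nonneg (by linarith)
    have h2 : -(1 / 1000) * (q : ℝ) ≤ -(13 * Real.log n) := by linarith
    refine (Real.exp_le_exp.2 h2).trans (le_of_eq ?_)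
    rw [Real.exp_neg, show (13 : ℝ) * Real.log n = ((13 : ℕ) : ℝ) * Real.log n by norm_num,
      Real.exp_nat_mul, Real.exp_log (by linarith)]
  have hBcard : (B.card : ℝ) ≤ 1 / (n : ℝ) ^ 10 * T := by
    have h1 : (B.card : ℝ) ≤ ∑ p : Fin n × Fin n, ((bad p).card : ℝ) := by
      exact_mod_cast Finset.card_biUnion_le
    have h2 : ∑ p : Fin n × Fin n, ((bad p).card : ℝ) ≤ ∑ p : Fin n × Fin n,
        2 * ((n : ℝ) ^ 13)⁻¹ * T := by
      refine Finset.sum_le_sum fun p _ => ?_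
      refine (card_filter_not_norm_preserving_le (y p.1 p.2) q).trans ?_
      gcongr
    refine h1.trans (h2.trans ?_)
    rw [Finset.sum_const, Finset.card_univ, Fintype.card_prod, Fintype.card_fin, nsmul_eq_mul]
    push_cast
    rw [← mul_assoc]
    refine mul_le_mul_of_nonneg_right ?_ hT0.le
    have hn0 : (n : ℝ) ≠ 0 := by positivity
    rw [show (n : ℝ) * n * (2 * ((n : ℝ) ^ 13)⁻¹) = (2 / n) * (1 / (n : ℝ) ^ 10) by field_simp]
    have : 2 / (n : ℝ) ≤ 1 := by rw [div_le_one (by linarith)]; exact hn2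
    have h3 : (0 : ℝ) ≤ 1 / (n : ℝ) ^ 10 := by positivity
    nlinarith
  have hsub : ((Bᶜ : Finset (Fin q → ι → Bool)) : Set (Fin q → ι → Bool)) ⊆ A := by
    intro Q hQ
    refine hA Q fun u v => ?_
    by_contra hc
    have : Q ∈ B := Finset.mem_biUnion.2 ⟨(u, v), Finset.mem_univ _,
      Finset.mem_filter.2 ⟨Finset.mem_univ _, hc⟩⟩
    simp only [Finset.coe_compl, Set.mem_compl_iff, Finset.mem_coe] at hQ
    exact hQ this
  refine le_trans ?_ (MeasureTheory.measure_mono hsub)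
  rw [ProbabilityTheory.uniformOn_univ, MeasureTheory.Measure.count_apply_finset,
    Finset.card_compl]
  have hle : B.card ≤ Fintype.card (Fin q → ι → Bool) := Finset.card_le_univ B
  rw [ENNReal.le_div_iff_mul_le (Or.inl (by simp)) (Or.inl (by simp)),
    ← ENNReal.ofReal_natCast, ← ENNReal.ofReal_natCast, ← ENNReal.ofReal_mul' (by positivity)]
  apply ENNReal.ofReal_le_ofReal
  rw [Nat.cast_sub hle, ← hT]
  linarith

/-! ### Costed computations -/

namespace Costed

variable {α β : Type}

@[simp] lemma pure_val (x : α) : (pure x : Costed α).val = x := rfl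
@[simp] lemma pure_time (x : α) : (pure x : Costed α).time = 0 := rfl
@[simp] lemma pure_space (x : α) : (pure x : Costed α).space = 0 := rfl
@[simp] lemma bind_val (x : Costed α) (f : α → Costed β) : (x >>= f).val = (f x.val).val := rfl
@[simp] lemma bind_time (x : Costed α) (f : α → Costed β) :
    (x >>= f).time = x.time + (f x.val).time := rfl
@[simp] lemma bind_space (x : Costed α) (f : α → Costed β) :
    (x >>= f).space = x.space + (f x.val).space := rfl

lemma foldlM_val {γ : Type*} (f : β → γ → Costed β) (l : List γ) (b : β) :
    (l.foldlM f b).val = l.foldl (fun b a => (f b a).val) b := by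
  induction l generalizing b with
  | nil => rfl
  | cons a l ih => rw [List.foldlM_cons, bind_val, ih, List.foldl_cons]

lemma foldlM_time_eq {γ : Type*} (f : β → γ → Costed β) (c : ℕ) (h : ∀ b a, (f b a).time = c)
    (l : List γ) (b : β) : (l.foldlM f b).time = l.length * c := by
  induction l generalizing b with
  | nil => simp
  | cons a l ih =>
    rw [List.foldlM_cons, bind_time, ih, h, List.length_cons]
    ring

lemma foldlM_time_le {γ : Type*} (f : β → γ → Costed β) (c : ℕ) (h : ∀ b a, (f b a).time ≤ c)
    (l : List γ) (b : β) : (l.foldlM f b).time ≤ l.length * c := by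
  induction l generalizing b with
  | nil => simp
  | cons a l ih =>
    rw [List.foldlM_cons, bind_time, List.length_cons, add_mul, one_mul, add_comm]
    exact add_le_add (ih _) (h _ _)

/-- Memory is reserved only through `alloc`, which charges equal time, so space never exceeds time
and the space bound will follow from the time bound. -/
lemma space_bind_le {x : Costed α} {f : α → Costed β} (hx : x.space ≤ x.time)
    (hf : ∀ a, (f a).space ≤ (f a).time) : (x >>= f).space ≤ (x >>= f).time := by
  rw [bind_space, bind_time]
  exact add_le_add hx (hf _)

lemma space_foldlM_le {γ : Type*} {f : β → γ → Costed β}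
    (hf : ∀ b a, (f b a).space ≤ (f b a).time) (l : List γ) (b : β) :
    (l.foldlM f b).space ≤ (l.foldlM f b).time := by
  induction l generalizing b with
  | nil => simp
  | cons a l ih =>
    rw [List.foldlM_cons]
    exact space_bind_le (hf _ _) fun b => ih b

end Costed

@[simp] lemma tick_time (t : ℕ) : (tick t).time = t := rfl
@[simp] lemma tick_space (t : ℕ) : (tick t).space = 0 := rfl
@[simp] lemma alloc_time (t : ℕ) : (alloc t).time = t := rfl
@[simp] lemma alloc_space (t : ℕ) : (alloc t).space = t := rfl

open Costed

variable {n : ℕ}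

/-! ### Values and running times of the subroutines -/

lemma foldl_add_eq {α β : Type*} (f : α → β → ℝ) (l : List α) (Y : β → ℝ) (x : β) :
    l.foldl (fun Y e => Y + f e) Y x = Y x + (l.map fun e => f e x).sum := by
  induction l generalizing Y with
  | nil => simp
  | cons a l ih =>
    rw [List.foldl_cons, ih, List.map_cons, List.sum_cons, Pi.add_apply]
    ring

/-- Linearity of the sketch: subtracting the columns of the removed edges gives the sketch of the
remaining graph, on which the decoder is guaranteed to work. -/
lemma removeEdges_val {s : ℕ} (S : Matrix (Fin s) (Pairs n) ℝ) (G : SimpleGraph (Fin n))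
    {F : Finset (Pairs n)} (hF : ∀ e ∈ F, e.1 ∈ G.edgeSet) :
    (removeEdges S (S * incidence G) F).val = S * incidence (without G F) := by
  classical
  have key : ∀ (l : List (Pairs n)) (Y : Matrix (Fin s) (Fin n) ℝ) i x,
      l.foldl (fun Y e => Matrix.of fun i x => Y i x - S i e * prow e x) Y i x =
        Y i x - (l.map fun e => S i e * prow e x).sum := by
    intro l
    induction l with
    | nil => simp
    | cons a l ih =>
      intro Y i x
      rw [List.foldl_cons, ih, List.map_cons, List.sum_cons, Matrix.of_apply]
      ring
  ext i x
  have hval : (removeEdges S (S * incidence G) F).val =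
      F.toList.foldl (fun Y e => Matrix.of fun i x => Y i x - S i e * prow e x)
        (S * incidence G) := by
    rw [removeEdges, foldlM_val]
    rfl
  rw [hval, key, Finset.sum_map_toList, Matrix.mul_apply, Matrix.mul_apply,
    ← Finset.sum_filter_add_sum_filter_not Finset.univ (· ∈ F)
      (fun e => S i e * incidence G e x),
    ← Finset.sum_filter_add_sum_filter_not Finset.univ (· ∈ F)
      (fun e => S i e * incidence (without G F) e x)]
  have hmem : ∀ e : Pairs n, e.1 ∈ (without G F).edgeSet ↔ e.1 ∈ G.edgeSet ∧ e ∉ F := by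
    intro e
    rw [without, SimpleGraph.edgeSet_deleteEdges, Set.mem_sdiff,
      Subtype.val_injective.mem_set_image, Finset.mem_coe]
  have e1 : ∑ e ∈ Finset.univ.filter (· ∈ F), S i e * incidence G e x =
      ∑ e ∈ F, S i e * prow e x := by
    rw [Finset.filter_univ_mem]
    refine Finset.sum_congr rfl fun e he => ?_
    rw [incidence, if_pos (hF e he)]
  have e2 : ∑ e ∈ Finset.univ.filter (· ∈ F), S i e * incidence (without G F) e x = 0 := by
    refine Finset.sum_eq_zero fun e he => ?_
    rw [incidence, if_neg fun h => ((hmem e).1 h).2 (Finset.mem_filter.1 he).2, mul_zero]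
  have e3 : ∑ e ∈ Finset.univ.filter (¬ · ∈ F), S i e * incidence (without G F) e x =
      ∑ e ∈ Finset.univ.filter (¬ · ∈ F), S i e * incidence G e x := by
    refine Finset.sum_congr rfl fun e he => ?_
    have : e.1 ∈ (without G F).edgeSet ↔ e.1 ∈ G.edgeSet :=
      (hmem e).trans (and_iff_left (Finset.mem_filter.1 he).2)
    simp only [incidence, this]
  rw [e1, e2, e3]
  ring

lemma removeEdges_time {s : ℕ} (S : Matrix (Fin s) (Pairs n) ℝ) (Y : Matrix (Fin s) (Fin n) ℝ)
    (F : Finset (Pairs n)) : (removeEdges S Y F).time = F.card * (1 + 10 * s) := by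
  rw [removeEdges, foldlM_time_eq _ (1 + 10 * s) (fun Y e => by simp), Finset.length_toList]

lemma removeEdges_space {s : ℕ} (S : Matrix (Fin s) (Pairs n) ℝ) (Y : Matrix (Fin s) (Fin n) ℝ)
    (F : Finset (Pairs n)) : (removeEdges S Y F).space = 0 := by
  unfold removeEdges
  induction F.toList generalizing Y with
  | nil => rfl
  | cons e l ih => simp [List.foldlM_cons, ih]

lemma foldl_update_cons {α : Type*} (label : α → Fin n) (l : List α)
    (T : Fin n → List α) (x : Fin n) :
    l.foldl (fun T v => Function.update T (label v) (v :: T (label v))) T x =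
      (l.filter fun v => label v = x).reverse ++ T x := by
  induction l generalizing T with
  | nil => simp
  | cons a l ih =>
    rw [List.foldl_cons, ih]
    by_cases h : label a = x
    · subst h
      simp
    · simp [h, Function.update_of_ne (Ne.symm h)]

lemma componentLists_val (label : Fin n → Fin n) (x : Fin n) :
    (componentLists label).val x = ((List.finRange n).filter fun v => label v = x).reverse := by
  rw [componentLists, bind_val, foldlM_val]
  have := foldl_update_cons label (List.finRange n) (fun _ => []) x
  rw [List.append_nil] at this
  exact this

lemma componentLists_time (label : Fin n → Fin n) : (componentLists label).time = n + n * 6 := by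
  rw [componentLists, bind_time, foldlM_time_eq _ 6 (fun T v => by simp), List.length_finRange]
  rfl

lemma foldl_update_add {α : Type*} [DecidableEq α] (c : α → ℝ) (l : List α) (y : α → ℝ) (x : α) :
    l.foldl (fun y v => Function.update y v (y v + c v)) y x =
      y x + (l.map fun v => if v = x then c v else 0).sum := by
  induction l generalizing y with
  | nil => simp
  | cons a l ih =>
    rw [List.foldl_cons, ih, List.map_cons, List.sum_cons]
    by_cases h : a = x
    · subst h
      simp only [Function.update_self, if_true]
      ring
    · rw [Function.update_of_ne (Ne.symm h), if_neg h, zero_add]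

/-- Pairs of weight `0` have zero rows, so visiting only the edges loses nothing. -/
lemma combineRows_val (H : WGraph n) (σ : Pairs n ⊕ Fin n → Bool) :
    (combineRows H σ).val = H.inc.transpose.mulVec fun j => sgn (σ j) := by
  classical
  funext x
  have h1 : (combineRows H σ).val x =
      (List.finRange n).foldl (fun y v => Function.update y v
        (y v + sgn (σ (Sum.inr v)) * Real.sqrt H.reg))
        (H.edges.toList.foldl (fun y e =>
          y + (sgn (σ (Sum.inl e)) * Real.sqrt (H.w e)) • prow e) 0) x := by
    rw [combineRows, bind_val, bind_val, foldlM_val, foldlM_val]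
    rfl
  rw [h1, foldl_update_add, foldl_add_eq (fun e => (sgn (σ (Sum.inl e)) * Real.sqrt (H.w e)) • prow e),
    ← Fin.sum_univ_def, Finset.sum_map_toList, Pi.zero_apply, zero_add, Finset.sum_ite_eq',
    if_pos (Finset.mem_univ _), Matrix.mulVec, dotProduct, Fintype.sum_sum_type]
  congr 1
  · rw [WGraph.edges, Finset.sum_filter]
    refine Finset.sum_congr rfl fun e _ => ?_
    simp only [WGraph.inc, Matrix.transpose_apply, Matrix.of_apply, Sum.elim_inl, Pi.smul_apply,
      smul_eq_mul]
    split_ifs with h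
    · ring
    · rw [not_not] at h
      simp [h]
  · simp only [WGraph.inc, Matrix.transpose_apply, Matrix.of_apply, Sum.elim_inr, Pi.smul_apply,
      smul_eq_mul]
    rw [Finset.sum_eq_single x]
    · simp
      ring
    · intro v _ hv
      simp [Ne.symm hv]
    · simp

lemma combineRows_time (H : WGraph n) (σ : Pairs n ⊕ Fin n → Bool) :
    (combineRows H σ).time = n + (H.edges.card * 14 + n * 7) := by
  rw [combineRows, bind_time, bind_time, foldlM_time_eq _ 14 (fun T v => by simp),
    foldlM_time_eq _ 7 (fun T v => by simp), List.length_finRange, Finset.length_toList]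
  rfl

lemma foldl_updateRow {q : ℕ} (c : Fin q → Fin n → ℝ) (l : List (Fin q))
    (M : Matrix (Fin q) (Fin n) ℝ) (i : Fin q) :
    l.foldl (fun M i => M.updateRow i (c i)) M i = if i ∈ l then c i else M i := by
  induction l generalizing M with
  | nil => simp
  | cons a l ih =>
    rw [List.foldl_cons, ih]
    by_cases h : i ∈ l
    · simp [h]
    · by_cases h' : i = a
      · subst h'
        simp [h, Matrix.updateRow_self]
      · simp [h, h']

lemma embedding_val (a : ℕ) (H : WGraph n) (Q : Signs n) (i : Fin (numRows n)) :
    (embedding a H Q).val i = (Real.sqrt (numRows n))⁻¹ •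
      (pinv H.laplacian).mulVec (H.inc.transpose.mulVec fun j => sgn (Q i j)) := by
  have h1 : (embedding a H Q).val = (List.finRange (numRows n)).foldl
      (fun M i => M.updateRow i ((Real.sqrt (numRows n))⁻¹ •
        (pinv H.laplacian).mulVec (combineRows H (Q i)).val)) 0 := by
    rw [embedding, bind_val, foldlM_val]
    rfl
  rw [h1]
  have h2 := foldl_updateRow (fun i => (Real.sqrt (numRows n))⁻¹ •
    (pinv H.laplacian).mulVec (combineRows H (Q i)).val) (List.finRange (numRows n)) 0 i
  rw [if_pos (List.mem_finRange i), combineRows_val] at h2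
  exact h2

lemma embedding_time (a : ℕ) (H : WGraph n) (Q : Signs n) :
    (embedding a H Q).time = numRows n * n + numRows n *
      (n + (H.edges.card * 14 + n * 7) + (nearlyLinear a n (H.edges.card + n) + (3 + 4 * n))) := by
  rw [embedding, bind_time, foldlM_time_eq _
    (n + (H.edges.card * 14 + n * 7) + (nearlyLinear a n (H.edges.card + n) + (3 + 4 * n)))
    (fun M i => by simp [combineRows_time, laplacianSolve]), List.length_finRange]
  rfl

lemma foldl_add_real {α : Type*} (f : α → ℝ) (l : List α) (b : ℝ) :
    l.foldl (fun s i => s + f i) b = b + (l.map f).sum := by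
  induction l generalizing b with
  | nil => simp
  | cons a l ih =>
    rw [List.foldl_cons, ih, List.map_cons, List.sum_cons]
    ring

lemma resM_val {q : ℕ} (M : Matrix (Fin q) (Fin n) ℝ) (u v : Fin n) :
    (resM M u v).val = 5 / 4 * ∑ i, (M i u - M i v) ^ 2 := by
  have h1 : (sqDist M u v).val = ∑ i, (M i u - M i v) ^ 2 := by
    rw [sqDist, foldlM_val, Fin.sum_univ_def]
    have := foldl_add_real (fun i => (M i u - M i v) ^ 2) (List.finRange q) 0
    rw [zero_add] at this
    exact this
  rw [← h1]
  rfl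

lemma resM_time {q : ℕ} (M : Matrix (Fin q) (Fin n) ℝ) (u v : Fin n) :
    (resM M u v).time = q * 6 + 1 := by
  rw [resM, bind_time, sqDist, foldlM_time_eq _ 6 (fun s i => by simp), List.length_finRange]
  rfl

/-- The running maximum starts at `0`, hence the assumption on `t`. -/
lemma maxResM_le_iff {q : ℕ} (M : Matrix (Fin q) (Fin n) ℝ) (u : Fin n) (C : List (Fin n))
    {t : ℝ} (ht : 0 ≤ t) : (maxResM M u C).val ≤ t ↔ ∀ v ∈ C, (resM M u v).val ≤ t := by
  have key : ∀ (l : List (Fin n)) (b : ℝ),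
      l.foldl (fun R v => max R (resM M u v).val) b ≤ t ↔
        b ≤ t ∧ ∀ v ∈ l, (resM M u v).val ≤ t := by
    intro l
    induction l with
    | nil => simp
    | cons a l ih =>
      intro b
      rw [List.foldl_cons, ih, max_le_iff, List.forall_mem_cons, and_assoc]
  have h1 : (maxResM M u C).val = C.foldl (fun R v => max R (resM M u v).val) 0 := by
    rw [maxResM, foldlM_val]
    rfl
  rw [h1, key, and_iff_right ht]

lemma maxResM_time {q : ℕ} (M : Matrix (Fin q) (Fin n) ℝ) (u : Fin n) (C : List (Fin n)) :
    (maxResM M u C).time = C.length * (q * 6 + 5) := by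
  rw [maxResM, foldlM_time_eq _ (q * 6 + 5) (fun s i => by simp [resM_time])]

lemma mem_carve {q : ℕ} (M : Matrix (Fin q) (Fin n) ℝ) (r : ℝ) (A : Finset (Fin n))
    (u v : Fin n) :
    v ∈ (carve M r A u).val ↔ v = u ∨ v ∈ A ∧ v ≠ u ∧ (resM M u v).val ≤ r := by
  set f : Finset (Fin n) → Fin n → Finset (Fin n) := fun P v =>
    if v ∈ A \ {u} then if (resM M u v).val ≤ r then insert v P else P else P with hf
  have key : ∀ (l : List (Fin n)) (P : Finset (Fin n)),
      v ∈ l.foldl f P ↔ v ∈ P ∨ v ∈ l ∧ v ∈ A ∧ v ≠ u ∧ (resM M u v).val ≤ r := by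
    intro l
    induction l with
    | nil => simp
    | cons a l ih =>
      intro P
      rw [List.foldl_cons, ih, List.mem_cons]
      have hstep : v ∈ f P a ↔ v ∈ P ∨ v = a ∧ v ∈ A ∧ v ≠ u ∧ (resM M u v).val ≤ r := by
        simp only [hf, Finset.mem_sdiff, Finset.mem_singleton]
        by_cases hva : v = a
        · subst hva
          split_ifs with h1 h2 <;> simp <;> tauto
        · split_ifs with h1 h2 <;> simp [hva]
      rw [hstep]
      tauto
  have hval : (carve M r A u).val = (List.finRange n).foldl f {u} := by
    rw [carve, bind_val, foldlM_val]
    congr 1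
    funext P v
    simp only [hf, bind_val]
    by_cases h1 : v ∈ A \ {u}
    · rw [if_pos h1, if_pos h1, bind_val, bind_val]
      by_cases h2 : (resM M u v).val ≤ r
      · rw [if_pos h2, if_pos h2]
        rfl
      · rw [if_neg h2, if_neg h2]
        rfl
    · rw [if_neg h1, if_neg h1]
      rfl
  rw [hval, key]
  simp

lemma carve_time_le {q : ℕ} (M : Matrix (Fin q) (Fin n) ℝ) (r : ℝ) (A : Finset (Fin n))
    (u : Fin n) : (carve M r A u).time ≤ 2 + n * (q * 6 + 8) := by
  rw [carve, bind_time, alloc_time]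
  refine Nat.add_le_add_left (le_trans (foldlM_time_le _ (q * 6 + 8) (fun P v => ?_) _ _) ?_) _
  · split_ifs with h1
    · simp only [bind_time, tick_time, resM_time]
      split_ifs <;> simp <;> omega
    · simp
  · rw [List.length_finRange]

/-! ### The main loop -/

section Loop

variable {q : ℕ} (M : Matrix (Fin q) (Fin n) ℝ) (r : ℝ) (comp : Fin n → List (Fin n))

/-- The invariant of the main loop; `U` is the set of the centres of the sets output so far. -/
structure LoopInv (X : LoopState n) (U : Finset (Fin n)) : Prop where
  active_subset : X.active ⊆ X.rest
  pairwise : X.out.Pairwise Disjoint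
  disjoint : ∀ P ∈ X.out, Disjoint P X.rest
  ball : ∀ P ∈ X.out, ∃ u, ∀ v ∈ P, v = u ∨ (resM M u v).val ≤ r
  card : U.card = X.out.length
  far : ∀ u ∈ U, ∀ w ∈ X.rest, r < (resM M u w).val
  separated : ∀ u ∈ U, ∀ u' ∈ U, u ≠ u' → r < (resM M u u').val
  witness : ∀ u ∈ U, ∃ v ∈ comp u, r / 2 < (resM M u v).val

open Classical in
/-- The vertices whose component has no active vertex. -/
def settled (X : LoopState n) : Finset (Fin n) :=
  Finset.univ.filter fun v => ∀ w ∈ comp v, w ∉ X.active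

lemma settled_mono {X Y : LoopState n} (h : Y.active ⊆ X.active) :
    settled comp X ⊆ settled comp Y := by
  intro v hv
  simp only [settled, Finset.mem_filter, Finset.mem_univ, true_and] at hv ⊢
  exact fun w hw hc => hv w hw (h hc)

lemma resM_comm (u v : Fin n) : (resM M u v).val = (resM M v u).val := by
  rw [resM_val, resM_val]
  congr 1
  exact Finset.sum_congr rfl fun i _ => by ring

lemma resM_self (u : Fin n) : (resM M u u).val = 0 := by
  rw [resM_val]
  simp

variable {M r comp}

/-- Amortised analysis: beyond a constant, a visit that discards a component is paid for by its
newly settled vertices at `6q + 8` each. A visit that outputs a set is paid for by that set, at the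
cost of scanning a component and carving from at most `n` vertices. -/
lemma visit_spec (hr : 0 < r) {label : Fin n → Fin n}
    (hcomp : ∀ u v, v ∈ comp u ↔ label v = label u) (hnodup : ∀ u, (comp u).Nodup)
    {X : LoopState n} {U : Finset (Fin n)} (hX : LoopInv M r comp X U) (u : Fin n) :
    ∃ U', LoopInv M r comp (visit M r comp X u).val U' ∧
      (visit M r comp X u).time + (q * 6 + 8) * (settled comp X).card +
          (4 + n * (q * 12 + 19)) * X.out.length ≤
        7 + (q * 6 + 8) * (settled comp (visit M r comp X u).val).card +
          (4 + n * (q * 12 + 19)) * (visit M r comp X u).val.out.length := by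
  classical
  have hlen : (comp u).length = (comp u).toFinset.card := (List.toFinset_card_of_nodup (hnodup u)).symm
  have hlen_le : (comp u).length ≤ n := by
    rw [hlen]
    simpa using Finset.card_le_univ (comp u).toFinset
  by_cases hu : u ∈ X.active
  · by_cases hR : (maxResM M u (comp u)).val ≤ r / 2
    · have hv : (visit M r comp X u).val = { X with active := X.active \ (comp u).toFinset } := by
        simp [visit, hu, hR]
      have ht : (visit M r comp X u).time =
          3 + ((comp u).length * (q * 6 + 5) + (4 + 3 * (comp u).length)) := by
        simp [visit, hu, hR, maxResM_time]
      refine ⟨U, ?_, ?_⟩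
      · rw [hv]
        exact ⟨Finset.sdiff_subset.trans hX.active_subset, hX.pairwise, hX.disjoint, hX.ball, hX.card,
          hX.far, hX.separated, hX.witness⟩
      -- Since `u` is still active, no vertex of its component was settled before; afterwards all of
      -- them are.
      · have hset : (settled comp X).card + (comp u).length ≤
            (settled comp (visit M r comp X u).val).card := by
          rw [hlen, ← Finset.card_union_of_disjoint]
          · refine Finset.card_le_card (Finset.union_subset (settled_mono _ ?_) fun v hvc => ?_)
            · rw [hv]
              exact Finset.sdiff_subset
            · rw [List.mem_toFinset, hcomp] at hvc
              simp only [settled, Finset.mem_filter, Finset.mem_univ, true_and, hv,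
                Finset.mem_sdiff, List.mem_toFinset, not_and, not_not]
              intro w hw _
              rw [hcomp] at hw ⊢
              exact hw.trans hvc
          · rw [Finset.disjoint_left]
            intro v h1 h2
            rw [List.mem_toFinset, hcomp] at h2
            exact (Finset.mem_filter.1 h1).2 u ((hcomp v u).2 h2.symm) hu
        rw [ht]
        have hmul := Nat.mul_le_mul_left (q * 6 + 8) hset
        have ho : (visit M r comp X u).val.out = X.out := by rw [hv]
        rw [ho]
        nlinarith
    · set P := (carve M r X.rest u).val with hP
      have hv : (visit M r comp X u).val =
          { active := X.active \ P, rest := X.rest \ P, out := X.out ++ [P] } := by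
        simp [visit, hu, hR, hP]
      have ht : (visit M r comp X u).time =
          3 + ((comp u).length * (q * 6 + 5) + (4 + ((carve M r X.rest u).time +
            (6 * P.card + 2)))) := by
        simp [visit, hu, hR, maxResM_time, hP]
      have hPmem : ∀ v, v ∈ P ↔ v = u ∨ v ∈ X.rest ∧ v ≠ u ∧ (resM M u v).val ≤ r :=
        fun v => mem_carve M r X.rest u v
      have huP : u ∈ P := (hPmem u).2 (Or.inl rfl)
      have hurest : u ∈ X.rest := hX.active_subset hu
      have hPrest : P ⊆ X.rest := fun v hvP => by
        rcases (hPmem v).1 hvP with rfl | h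
        · exact hurest
        · exact h.1
      have huU : u ∉ U := fun h => by
        have := hX.far u h u hurest
        rw [resM_self] at this
        linarith
      refine ⟨insert u U, ?_, ?_⟩
      · rw [hv]
        refine ⟨Finset.sdiff_subset_sdiff hX.active_subset le_rfl, ?_, ?_, ?_, ?_, ?_, ?_, ?_⟩
        · refine List.pairwise_append.2 ⟨hX.pairwise, List.pairwise_singleton _ _, ?_⟩
          intro A hA B hB
          rw [List.mem_singleton] at hB
          subst hB
          exact (hX.disjoint A hA).mono_right hPrest
        · intro A hA
          rcases List.mem_append.1 hA with hA | hA
          · exact (hX.disjoint A hA).mono_right Finset.sdiff_subset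
          · rw [List.mem_singleton] at hA
            subst hA
            exact Finset.disjoint_sdiff
        · intro A hA
          rcases List.mem_append.1 hA with hA | hA
          · exact hX.ball A hA
          · rw [List.mem_singleton] at hA
            subst hA
            exact ⟨u, fun v hvP => ((hPmem v).1 hvP).imp_right fun h => h.2.2⟩
        · rw [Finset.card_insert_of_notMem huU, hX.card]
          simp
        · intro c hc w hw
          simp only [Finset.mem_sdiff] at hw
          rcases Finset.mem_insert.1 hc with rfl | hc
          · by_contra hle
            refine hw.2 ((hPmem w).2 ?_)
            by_cases hwc : w = c
            · exact Or.inl hwc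
            · exact Or.inr ⟨hw.1, hwc, not_lt.1 hle⟩
          · exact hX.far c hc w hw.1
        -- An earlier centre is at distance more than `r` from everything left in `V'`, and the new
        -- centre is still there.
        · intro c hc c' hc' hne
          rcases Finset.mem_insert.1 hc with h1 | h1 <;>
            rcases Finset.mem_insert.1 hc' with h2 | h2
          · exact absurd (h1.trans h2.symm) hne
          · rw [resM_comm, h1]
            exact hX.far c' h2 u hurest
          · rw [h2]
            exact hX.far c h1 u hurest
          · exact hX.separated c h1 c' h2 hne
        · intro c hc
          rcases Finset.mem_insert.1 hc with rfl | hc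
          · rw [maxResM_le_iff M c (comp c) (by linarith)] at hR
            push Not at hR
            exact hR
          · exact hX.witness c hc
      · have hset : (settled comp X).card ≤ (settled comp (visit M r comp X u).val).card := by
          refine Finset.card_le_card (settled_mono _ ?_)
          rw [hv]
          exact Finset.sdiff_subset
        have ho : (visit M r comp X u).val.out.length = X.out.length + 1 := by rw [hv]; simp
        have hPn : P.card ≤ n := by simpa using Finset.card_le_univ P
        have hc := carve_time_le M r X.rest u
        have hm := Nat.mul_le_mul_right (q * 6 + 5) hlen_le
        have hmul := Nat.mul_le_mul_left (q * 6 + 8) hset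
        rw [ht, ho]
        nlinarith
  · have hv : (visit M r comp X u).val = X := by simp [visit, hu]
    have ht : (visit M r comp X u).time = 3 := by simp [visit, hu]
    exact ⟨U, by rwa [hv], by rw [hv, ht]; omega⟩

lemma foldlM_visit_spec (hr : 0 < r) {label : Fin n → Fin n}
    (hcomp : ∀ u v, v ∈ comp u ↔ label v = label u) (hnodup : ∀ u, (comp u).Nodup)
    (l : List (Fin n)) {X : LoopState n} {U : Finset (Fin n)} (hX : LoopInv M r comp X U) :
    ∃ U', LoopInv M r comp (l.foldlM (visit M r comp) X).val U' ∧
      (l.foldlM (visit M r comp) X).time + (q * 6 + 8) * (settled comp X).card +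
          (4 + n * (q * 12 + 19)) * X.out.length ≤
        7 * l.length + (q * 6 + 8) * (settled comp (l.foldlM (visit M r comp) X).val).card +
          (4 + n * (q * 12 + 19)) * (l.foldlM (visit M r comp) X).val.out.length := by
  induction l generalizing X U with
  | nil => exact ⟨U, hX, by simp⟩
  | cons a l ih =>
    obtain ⟨U₁, h1, t1⟩ := visit_spec hr hcomp hnodup hX a
    obtain ⟨U₂, h2, t2⟩ := ih h1
    refine ⟨U₂, by simpa [List.foldlM_cons] using h2, ?_⟩
    rw [List.foldlM_cons, bind_time, bind_val, List.length_cons]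
    linarith

/-- The main loop from its initial state. -/
lemma loop_spec (hr : 0 < r) {label : Fin n → Fin n}
    (hcomp : ∀ u v, v ∈ comp u ↔ label v = label u) (hnodup : ∀ u, (comp u).Nodup)
    (π : Equiv.Perm (Fin n)) :
    let X := ((List.finRange n).map π).foldlM (visit M r comp)
      { active := Finset.univ, rest := Finset.univ, out := [] }
    ∃ U, LoopInv M r comp X.val U ∧
      X.time ≤ n * (q * 6 + 15) + (4 + n * (q * 12 + 19)) * X.val.out.length := by
  intro X
  obtain ⟨U, h1, h2⟩ := foldlM_visit_spec (M := M) hr hcomp hnodup ((List.finRange n).map π)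
    (X := { active := Finset.univ, rest := Finset.univ, out := [] }) (U := ∅)
    ⟨le_rfl, List.Pairwise.nil, by simp, by simp, by simp, by simp, by simp, by simp⟩
  refine ⟨U, h1, ?_⟩
  have h3 : (settled comp X.val).card ≤ n := by
    simpa using Finset.card_le_univ (settled comp X.val)
  have h4 := Nat.mul_le_mul_left (q * 6 + 8) h3
  simp only [List.length_map, List.length_finRange, List.length_nil, mul_zero, add_zero] at h2
  change X.time + _ ≤ 7 * n + (q * 6 + 8) * (settled comp X.val).card + _ * X.val.out.length at h2
  nlinarith

end Loop

/-! ### Space -/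

lemma space_carveFromSketch_le (a : ℕ) {s : ℕ}
    (decode : Matrix (Fin s) (Fin n) ℝ → Fin n → Fin n) (Y : Matrix (Fin s) (Fin n) ℝ) (r : ℝ)
    (H : WGraph n) (π : Equiv.Perm (Fin n)) (Q : Signs n) :
    (carveFromSketch a decode Y r H π Q).space ≤ (carveFromSketch a decode Y r H π Q).time := by
  have htick : ∀ t, (tick t).space ≤ (tick t).time := fun t => by simp
  have halloc : ∀ t, (alloc t).space ≤ (alloc t).time := fun t => by simp
  have hpure : ∀ {α : Type} (x : α), (pure x : Costed α).space ≤ (pure x : Costed α).time :=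
    fun x => by simp
  have hres : ∀ {q : ℕ} (M : Matrix (Fin q) (Fin n) ℝ) u v,
      (resM M u v).space ≤ (resM M u v).time := fun M u v =>
    space_bind_le (space_foldlM_le (fun _ _ => space_bind_le (htick _) fun _ => hpure _) _ _)
      fun _ => space_bind_le (htick _) fun _ => hpure _
  refine space_bind_le (halloc _) fun _ => space_bind_le ?_ fun label => space_bind_le ?_
    fun lists => space_bind_le ?_ fun M => space_bind_le (halloc _) fun _ => space_bind_le ?_
    fun X => hpure _
  · exact space_bind_le (halloc _) fun _ => hpure _
  · exact space_bind_le (halloc _) fun _ => space_foldlM_le (fun _ _ => space_bind_le (htick _)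
      fun _ => space_bind_le (halloc _) fun _ => hpure _) _ _
  · refine space_bind_le (halloc _) fun _ => space_foldlM_le (fun _ _ => space_bind_le ?_
      fun _ => space_bind_le ?_ fun _ => space_bind_le (htick _) fun _ => hpure _) _ _
    · exact space_bind_le (halloc _) fun _ => space_bind_le (space_foldlM_le (fun _ _ =>
        space_bind_le (htick _) fun _ => hpure _) _ _) fun _ => space_foldlM_le (fun _ _ =>
        space_bind_le (htick _) fun _ => hpure _) _ _
    · exact space_bind_le (halloc _) fun _ => hpure _
  · refine space_foldlM_le (fun X u => ?_) _ _
    refine space_bind_le (htick _) fun _ => ?_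
    split_ifs
    · refine space_bind_le (space_foldlM_le (fun _ _ => space_bind_le (hres _ _ _) fun _ =>
        space_bind_le (htick _) fun _ => hpure _) _ _) fun R => space_bind_le (htick _) fun _ => ?_
      split_ifs
      · exact space_bind_le (htick _) fun _ => hpure _
      · refine space_bind_le ?_ fun P => space_bind_le (htick _) fun _ =>
          space_bind_le (halloc _) fun _ => hpure _
        refine space_bind_le (halloc _) fun _ => space_foldlM_le (fun P v => ?_) _ _
        refine space_bind_le (htick _) fun _ => ?_
        split_ifs
        · refine space_bind_le (hres _ _ _) fun s => space_bind_le (htick _) fun _ => ?_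
          split_ifs
          · exact space_bind_le (halloc _) fun _ => hpure _
          · exact hpure _
        · exact hpure _
    · exact hpure _

/-! ### The embedding -/

/-- The vector of currents `B̃ L̃⁺ b_{uv}`. -/
def currents (H : WGraph n) (u v : Fin n) : Pairs n ⊕ Fin n → ℝ :=
  H.inc.mulVec ((pinv H.laplacian).mulVec (bvec u v))

lemma sum_currents_sq (H : WGraph n) (hH : Conducting H.laplacian) (u v : Fin n) :
    ∑ e, currents H u v e ^ 2 = reff H.laplacian u v := by
  have h1 : ∑ e, currents H u v e ^ 2 = currents H u v ⬝ᵥ currents H u v := by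
    simp [dotProduct, sq]
  rw [h1, currents, ← H.laplacian_form, mulVec_pinv_mulVec H.laplacian_isHermitian (hH u v),
    dotProduct_comm, reff]

/-- Symmetry of the pseudoinverse moves it from the random combination of rows to `b_{uv}`, which
exhibits the entry as a signed sum of currents. -/
lemma embedding_sub (a : ℕ) (H : WGraph n) (Q : Signs n) (i : Fin (numRows n)) (u v : Fin n) :
    (embedding a H Q).val i u - (embedding a H Q).val i v =
      (Real.sqrt (numRows n))⁻¹ * signedSum (currents H u v) (Q i) := by
  rw [← bvec_dotProduct, embedding_val, dotProduct_smul, smul_eq_mul,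
    dotProduct_mulVec_comm (pinv_isHermitian H.laplacian_isHermitian), dotProduct_comm,
    Matrix.dotProduct_mulVec, Matrix.vecMul_transpose]
  congr 1
  simp only [dotProduct, signedSum, currents]
  exact Finset.sum_congr rfl fun e _ => mul_comm _ _

lemma resM_embedding (a : ℕ) (H : WGraph n) (Q : Signs n) (u v : Fin n) :
    (resM (embedding a H Q).val u v).val =
      5 / 4 * ((∑ i, signedSum (currents H u v) (Q i) ^ 2) / numRows n) := by
  rw [resM_val, Finset.sum_div]
  congr 1
  refine Finset.sum_congr rfl fun i _ => ?_
  rw [embedding_sub, mul_pow, inv_pow, Real.sq_sqrt (Nat.cast_nonneg _), div_eq_inv_mul]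

/-- If the signs nearly preserve the norms of the currents, then `R^M` approximates the effective
resistances. -/
lemma resM_embedding_bounds (a : ℕ) (H : WGraph n) (hH : Conducting H.laplacian) (Q : Signs n)
    (hq : 0 < numRows n) (u v : Fin n)
    (h : 4 / 5 * (∑ e, currents H u v e ^ 2) * numRows n ≤
        ∑ i, signedSum (currents H u v) (Q i) ^ 2 ∧
      ∑ i, signedSum (currents H u v) (Q i) ^ 2 ≤
        6 / 5 * (∑ e, currents H u v e ^ 2) * numRows n) :
    reff H.laplacian u v ≤ (resM (embedding a H Q).val u v).val ∧
      (resM (embedding a H Q).val u v).val ≤ 3 / 2 * reff H.laplacian u v := by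
  have hq' : (0 : ℝ) < numRows n := by exact_mod_cast hq
  rw [sum_currents_sq H hH, ← le_div_iff₀ hq', ← div_le_iff₀ hq'] at h
  rw [resM_embedding]
  constructor <;> linarith [h.1, h.2]

/-! ### Connectivity -/

open Classical in
/-- Vertices that stay connected after removing all edges of connectivity at most `d` have
connectivity more than `d`. -/
lemma le_card_interedges_of_reachable {G : SimpleGraph (Fin n)} {F : Finset (Pairs n)} {d : ℝ}
    (hF : ∀ e : Pairs n, ∀ u v, e.1 = s(u, v) → G.Adj u v → (edgeConn G u v : ℝ) ≤ d → e ∈ F)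
    {u v : Fin n} (huv : (without G F).Reachable u v) (S : Finset (Fin n)) (hu : u ∈ S)
    (hv : v ∉ S) : d ≤ (G.interedges S Sᶜ).card := by
  obtain ⟨p⟩ := huv
  obtain ⟨e, -, h1, h2⟩ := p.exists_boundary_dart (S : Set (Fin n)) hu hv
  have hadj := (SimpleGraph.deleteEdges_adj (s := Subtype.val '' (F : Set (Pairs n)))).1 e.adj
  have hnd : ¬ (s(e.fst, e.snd)).IsDiag := by
    rw [Sym2.mk_isDiag_iff]
    exact hadj.1.ne
  have hnF : (⟨s(e.fst, e.snd), hnd⟩ : Pairs n) ∉ F := fun hmem =>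
    hadj.2 ⟨⟨s(e.fst, e.snd), hnd⟩, hmem, rfl⟩
  -- A path surviving the removal crosses the cut along an edge outside `F`, whose connectivity
  -- therefore exceeds `d`.
  have hlt : d < edgeConn G e.fst e.snd := by
    by_contra hc
    exact hnF (hF _ e.fst e.snd rfl hadj.1 (not_lt.1 hc))
  have hle : edgeConn G e.fst e.snd ≤ (G.interedges S Sᶜ).card :=
    Nat.sInf_le ⟨S, h1, h2, rfl⟩
  exact hlt.le.trans (by exact_mod_cast hle)

/-! ### The procedure after the update of the sketch -/

/-- Holds for all signs and all labels: output and time are controlled by the centres, whatever the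
quality of `M` or of the decoder. -/
lemma carveFromSketch_spec (a : ℕ) {s : ℕ} (decode : Matrix (Fin s) (Fin n) ℝ → Fin n → Fin n)
    (Y : Matrix (Fin s) (Fin n) ℝ) {r : ℝ} (hr : 0 < r) (H : WGraph n) (π : Equiv.Perm (Fin n))
    (Q : Signs n) :
    ∃ (X : LoopState n) (U : Finset (Fin n)) (comp : Fin n → List (Fin n)),
      (carveFromSketch a decode Y r H π Q).val = X.out ∧
      (∀ u v, v ∈ comp u ↔ decode Y v = decode Y u) ∧
      LoopInv (embedding a H Q).val r comp X U ∧
      (carveFromSketch a decode Y r H π Q).time ≤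
        s * n + 3 * H.edges.card + 2 + nearlyLinear a n n + 9 * n +
          (embedding a H Q).time + n * (numRows n * 6 + 15) +
          (4 + n * (numRows n * 12 + 19)) * U.card := by
  set comp : Fin n → List (Fin n) := fun u => (componentLists (decode Y)).val (decode Y u)
    with hcomp
  have hmem : ∀ u v, v ∈ comp u ↔ decode Y v = decode Y u := by
    intro u v
    simp [hcomp, componentLists_val]
  have hnodup : ∀ u, (comp u).Nodup := by
    intro u
    simp only [hcomp, componentLists_val, List.nodup_reverse]
    exact (List.nodup_finRange n).filter _
  obtain ⟨U, hU, ht⟩ := loop_spec (M := (embedding a H Q).val) hr hmem hnodup π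
  refine ⟨_, U, comp, rfl, hmem, hU, ?_⟩
  rw [← hU.card] at ht
  have htime : (carveFromSketch a decode Y r H π Q).time =
      (s * n + 3 * H.edges.card + 2) + (nearlyLinear a n n + ((n + n * 6) +
        ((embedding a H Q).time + (2 * n + (((List.finRange n).map π).foldlM
          (visit (embedding a H Q).val r comp)
          { active := Finset.univ, rest := Finset.univ, out := [] }).time)))) := by
    rw [← componentLists_time (decode Y)]
    rfl
  rw [htime]
  omega

/-! ### Numerical estimates -/

lemma natLog_add_one_le {n : ℕ} (hn : 2 ≤ n) : ((Nat.log 2 n + 1 : ℕ) : ℝ) ≤ 3 * Real.log n := by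
  have h2 : (0.693 : ℝ) < Real.log 2 := by linarith [Real.log_two_gt_d9]
  have hn0 : (0 : ℝ) < n := by positivity
  have h1 : (Nat.log 2 n : ℝ) * Real.log 2 ≤ Real.log n := by
    have := Real.log_le_log (by positivity)
      (show ((2 : ℝ) ^ Nat.log 2 n) ≤ n by exact_mod_cast Nat.pow_log_le_self 2 (by omega))
    rwa [Real.log_pow] at this
  have h3 : Real.log 2 ≤ Real.log n := Real.log_le_log (by norm_num) (by exact_mod_cast hn)
  push_cast
  have h4 : (0 : ℝ) ≤ Nat.log 2 n := Nat.cast_nonneg _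
  nlinarith

lemma log_le_natLog_add_one (n : ℕ) : Real.log n ≤ ((Nat.log 2 n + 1 : ℕ) : ℝ) := by
  rcases Nat.eq_zero_or_pos n with rfl | hn
  · simp
  have h1 : (n : ℝ) ≤ 2 ^ (Nat.log 2 n + 1) := by
    exact_mod_cast (Nat.lt_pow_succ_log_self (by norm_num) n).le
  have h2 := Real.log_le_log (by exact_mod_cast hn) h1
  rw [Real.log_pow] at h2
  have h3 : Real.log 2 ≤ 1 := by linarith [Real.log_two_lt_d9]
  have h4 : (0 : ℝ) ≤ ((Nat.log 2 n + 1 : ℕ) : ℝ) := Nat.cast_nonneg _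
  nlinarith

lemma numRows_pos {n : ℕ} (hn : 2 ≤ n) : 0 < numRows n :=
  Nat.ceil_pos.2 (mul_pos (by norm_num) (Real.log_pos (by exact_mod_cast hn)))

lemma numRows_le (n : ℕ) : (numRows n : ℝ) ≤ 2 * 10 ^ 6 * ((Nat.log 2 n + 1 : ℕ) : ℝ) := by
  have h1 := log_le_natLog_add_one n
  have h0 : 0 ≤ Real.log n := Real.log_natCast_nonneg n
  have h2 : (numRows n : ℝ) < 10 ^ 6 * Real.log n + 1 := Nat.ceil_lt_add_one (by positivity)
  have h3 : (1 : ℝ) ≤ ((Nat.log 2 n + 1 : ℕ) : ℝ) := by exact_mod_cast Nat.le_add_left 1 _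
  linarith

/-- The bound on the number of centres, with explicit constants. -/
lemma centres_bound_le {g k Δ r Γ d : ℝ} (hg : 1 ≤ g) (hk : 1 ≤ k) (hr : 0 < r) (hΓ : 1 ≤ Γ)
    (hd : 0 < d) (hΔ : Δ < r / Γ / (800 * Real.sqrt k)) :
    20 * k * (64 * (8 * g ^ 2 + 1) ^ 2 * Δ) / (r / (24 * Γ)) +
      8 * (256 * (8 * g ^ 2 + 1) ^ 2 * k * (3 * g)) / (d * (r / (24 * Γ))) ≤
      2 * 10 ^ 7 * g ^ 5 * (Real.sqrt k + k * Γ / (r * d)) := by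
  have hΓ0 : 0 < Γ := by linarith
  have hs : 0 < Real.sqrt k := Real.sqrt_pos.2 (by linarith)
  have hsk : Real.sqrt k * Real.sqrt k = k := Real.mul_self_sqrt (by linarith)
  have hc : (8 * g ^ 2 + 1) ^ 2 ≤ 81 * g ^ 4 := by
    have h1 : 8 * g ^ 2 + 1 ≤ 9 * g ^ 2 := by nlinarith
    calc (8 * g ^ 2 + 1) ^ 2 ≤ (9 * g ^ 2) ^ 2 := pow_le_pow_left₀ (by positivity) h1 2
      _ = 81 * g ^ 4 := by ring
  have hg45 : g ^ 4 ≤ g ^ 5 := pow_le_pow_right₀ hg (by norm_num)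
  have e1 : 20 * k * (64 * (8 * g ^ 2 + 1) ^ 2 * Δ) / (r / (24 * Γ)) ≤
      2 * 10 ^ 7 * g ^ 5 * Real.sqrt k := by
    have h1 : 20 * k * (64 * (8 * g ^ 2 + 1) ^ 2 * Δ) / (r / (24 * Γ)) =
        30720 * (8 * g ^ 2 + 1) ^ 2 * (k * (Δ * Γ / r)) := by
      field_simp
      ring
    have h2 : Δ * Γ / r ≤ 1 / (800 * Real.sqrt k) := by
      rw [div_le_div_iff₀ hr (by positivity)]
      rw [lt_div_iff₀ (by positivity), lt_div_iff₀ hΓ0] at hΔ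
      linarith
    -- The assumption on `Δ` turns `k` into `√k`; the factor `800` is given away here.
    have h3 : k * (Δ * Γ / r) ≤ Real.sqrt k := by
      refine (mul_le_mul_of_nonneg_left h2 (by linarith)).trans ?_
      rw [mul_one_div, div_le_iff₀ (by positivity)]
      nlinarith
    rw [h1]
    calc 30720 * (8 * g ^ 2 + 1) ^ 2 * (k * (Δ * Γ / r))
        ≤ 30720 * (8 * g ^ 2 + 1) ^ 2 * Real.sqrt k :=
          mul_le_mul_of_nonneg_left h3 (by positivity)
      _ ≤ 2 * 10 ^ 7 * g ^ 5 * Real.sqrt k :=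
          mul_le_mul_of_nonneg_right (by nlinarith [pow_pos (by linarith : 0 < g) 5]) hs.le
  have e2 : 8 * (256 * (8 * g ^ 2 + 1) ^ 2 * k * (3 * g)) / (d * (r / (24 * Γ))) ≤
      2 * 10 ^ 7 * g ^ 5 * (k * Γ / (r * d)) := by
    have h1 : 8 * (256 * (8 * g ^ 2 + 1) ^ 2 * k * (3 * g)) / (d * (r / (24 * Γ))) =
        147456 * (8 * g ^ 2 + 1) ^ 2 * g * (k * Γ / (r * d)) := by
      field_simp
      norm_num
    rw [h1]
    refine mul_le_mul_of_nonneg_right ?_ (by positivity)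
    calc 147456 * (8 * g ^ 2 + 1) ^ 2 * g ≤ 147456 * (81 * g ^ 4) * g := by gcongr
      _ = 11943936 * g ^ 5 := by ring
      _ ≤ _ := by
        refine mul_le_mul_of_nonneg_right (by norm_num) (by positivity)
  rw [mul_add]
  exact add_le_add e1 e2

/-- The bound on the running time, with explicit constants. -/
lemma time_bound_le {n s m A q t g Z ε : ℝ} (hn : 1 ≤ n) (hs : s ≤ A) (hm0 : 0 ≤ m)
    (hm : m ≤ A * (n / ε ^ 2)) (hA : 1 ≤ A) (hq1 : 1 ≤ q) (hq : q ≤ 2 * 10 ^ 6 * g) (hg : 1 ≤ g)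
    (ht0 : 0 ≤ t) (ht : t ≤ 2 * 10 ^ 7 * g ^ 5 * Z) (hZ : 1 ≤ Z) :
    s * n + 3 * m + 2 + n * A + 9 * n +
        (q * n + q * (n + (m * 14 + n * 7) + ((m + n) * A + (3 + 4 * n)))) +
        n * (q * 6 + 15) + (4 + n * (q * 12 + 19)) * t ≤
      10 ^ 16 * (A ^ 2 * g ^ 6) * (n * Z + n / ε ^ 2) := by
  have hqA : 1 ≤ q * A := one_le_mul_of_one_le_of_one_le hq1 hA
  have hn0 : 0 ≤ n := by linarith
  have hAn : A * n ≤ q * A * n := mul_le_mul_of_nonneg_right (by nlinarith) hn0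
  have hnA : n ≤ q * A * n := by nlinarith
  have hqn : q * n ≤ q * A * n := mul_le_mul_of_nonneg_right (by nlinarith) hn0
  have hsn : s * n ≤ q * A * n := (mul_le_mul_of_nonneg_right hs hn0).trans hAn
  have hmA : m ≤ q * A * m := by nlinarith
  have hqm : q * m ≤ q * A * m := mul_le_mul_of_nonneg_right (by nlinarith) hm0
  have hq3 : q * 3 ≤ 3 * (q * A * n) := by nlinarith
  have hloop : (4 + n * (q * 12 + 19)) * t ≤ 35 * (q * n * t) := by
    have h1 : 4 + n * (q * 12 + 19) ≤ 35 * (q * n) := by nlinarith [mul_le_mul hq1 hn (by norm_num) (by linarith)]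
    calc _ ≤ 35 * (q * n) * t := mul_le_mul_of_nonneg_right h1 ht0
      _ = _ := by ring
  -- Three contributions dominate: the solver calls on vertices, the solver calls on edges, and the
  -- carving around the centres.
  have hsum : s * n + 3 * m + 2 + n * A + 9 * n +
        (q * n + q * (n + (m * 14 + n * 7) + ((m + n) * A + (3 + 4 * n)))) +
        n * (q * 6 + 15) + (4 + n * (q * 12 + 19)) * t ≤
      60 * (q * A * n) + 18 * (q * A * m) + 35 * (q * n * t) := by
    nlinarith
  refine hsum.trans ?_
  have hg6 : g ≤ g ^ 6 := le_self_pow₀ hg (by norm_num)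
  have hA2 : A ≤ A ^ 2 := le_self_pow₀ hA (by norm_num)
  have hA0 : 0 < A := by linarith
  have hg0 : 0 < g := by linarith
  have b1 : q * A * n ≤ 2 * 10 ^ 6 * (A ^ 2 * g ^ 6) * (n * Z) := by
    calc q * A * n ≤ (2 * 10 ^ 6 * g ^ 6) * A ^ 2 * (n * Z) := by
          gcongr
          · linarith
          · nlinarith
      _ = _ := by ring
  have b2 : q * A * m ≤ 2 * 10 ^ 6 * (A ^ 2 * g ^ 6) * (n / ε ^ 2) := by
    calc q * A * m ≤ (2 * 10 ^ 6 * g ^ 6) * A * (A * (n / ε ^ 2)) := by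
          gcongr
          linarith
      _ = _ := by ring
  have b3 : q * n * t ≤ 4 * 10 ^ 13 * (A ^ 2 * g ^ 6) * (n * Z) := by
    calc q * n * t ≤ (2 * 10 ^ 6 * g) * n * (2 * 10 ^ 7 * g ^ 5 * Z) := by gcongr
      _ = 4 * 10 ^ 13 * (1 * g ^ 6) * (n * Z) := by ring
      _ ≤ _ := by
        gcongr
        nlinarith
  have hE : 0 ≤ A ^ 2 * g ^ 6 * (n / ε ^ 2) := by positivity
  have hZ' : 0 ≤ A ^ 2 * g ^ 6 * (n * Z) := by positivity
  nlinarith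

/-! ### The theorem for fixed signs -/

/-- Whenever `R^M` approximates the effective resistances, the main loop has few centres. -/
lemma card_centres_le_of_loopInv {G : SimpleGraph (Fin n)} {F : Finset (Pairs n)}
    {d Γ r Δ γ : ℝ} {k : ℕ} {cl : Fin n → Fin k} {R : Fin n → Fin n → ℝ} {q : ℕ}
    {M : Matrix (Fin q) (Fin n) ℝ} {comp : Fin n → List (Fin n)} {X : LoopState n}
    {U : Finset (Fin n)} (hd : 1 ≤ d) (hΓ : 1 ≤ Γ) (hr : 0 < r) (hk : 1 ≤ k) (hΔ0 : 0 < Δ)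
    (hΔ : Δ < r / Γ / (800 * Real.sqrt k)) (hdiam : ∀ i, InducedDiamLE G {v | cl v = i} Δ)
    (hγ : 0 ≤ γ) (hcond : Conducting (lapReg G γ))
    (hRG : ∀ u v, R u v ≤ 2 * Γ * reff (lapReg G γ) u v)
    (hF : ∀ e : Pairs n, ∀ u v, e.1 = s(u, v) → G.Adj u v → (edgeConn G u v : ℝ) ≤ d → e ∈ F)
    (hcomp : ∀ u v, v ∈ comp u → (without G F).Reachable u v)
    (hM : ∀ u v, (resM M u v).val ≤ 3 / 2 * R u v) (hU : LoopInv M r comp X U) :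
    (U.card : ℝ) ≤ 2 * 10 ^ 7 * ((Nat.log 2 n + 1 : ℕ) : ℝ) ^ 5 *
      (Real.sqrt k + k * Γ / (r * d)) := by
  classical
  have hk1 : (1 : ℝ) ≤ k := by exact_mod_cast hk
  have hΓ0 : 0 < Γ := by linarith
  have : Nonempty (Fin k) := ⟨⟨0, hk⟩⟩
  set g := Nat.log 2 n + 1 with hg
  have hg1 : (1 : ℝ) ≤ g := by exact_mod_cast Nat.le_add_left 1 _
  have hD := lapReg_isDirichlet G hγ
  have hscale : ∀ u v, (resM M u v).val ≤ 3 * Γ * reff (lapReg G γ) u v := fun u v => by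
    linarith [hM u v, hRG u v]
  -- Since `R^M ≤ 3Γ R^G`, the bound `R^M > r` between centres gives resistance above `8ρ`, and a
  -- witness with `R^M > r / 2` has resistance above `4ρ`, for `ρ = r / (24Γ)`.
  have hρ : 0 < r / (24 * Γ) := by positivity
  have hρeq : 24 * Γ * (r / (24 * Γ)) = r := by field_simp
  have hΔρ : Δ ≤ 4 * (r / (24 * Γ)) := by
    have h1 : r / Γ / (800 * Real.sqrt k) ≤ r / Γ / 800 := by
      have : 1 ≤ Real.sqrt k := Real.one_le_sqrt.2 hk1
      gcongr
      linarith
    have h2 : r / Γ / 800 ≤ 4 * (r / (24 * Γ)) := by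
      rw [show 4 * (r / (24 * Γ)) = r / Γ / 6 by field_simp; norm_num]
      have : 0 < r / Γ := by positivity
      linarith
    linarith
  have hbound := card_centres_le G (reff (lapReg G γ)) (reff_self _) (reff_triangle hD hcond)
    (reff_comm _) cl (Δ := Δ) (θ := 64 * (8 * (g : ℝ) ^ 2 + 1) ^ 2 * Δ) (ρ := r / (24 * Γ))
    (d := d) (fun u v huv => (hdiam (cl v)).reff_le hΔ0.le hγ huv rfl hcond)
    (by nlinarith [sq_nonneg (g : ℝ), sq_nonneg ((g : ℝ) ^ 2)]) (by positivity) hΔρ hρ (by linarith)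
    (sum_heavyPairs_le G cl hΔ0 hγ hcond hdiam (by omega)
      (by simpa using Nat.lt_pow_succ_log_self (by norm_num) n)) U
    (fun u hu u' hu' hne => by
      have h1 := hU.separated u hu u' hu' hne
      have h2 := hscale u u'
      by_contra hc
      have := mul_le_mul_of_nonneg_left (not_lt.1 hc) (by positivity : 0 ≤ 3 * Γ)
      linarith)
    (fun u hu => by
      obtain ⟨v, hv, hlt⟩ := hU.witness u hu
      refine ⟨v, ?_, fun S h1 h2 => ?_⟩
      · have h2 := hscale u v
        by_contra hc
        have := mul_le_mul_of_nonneg_left (not_lt.1 hc) (by positivity : 0 ≤ 3 * Γ)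
        linarith
      · convert le_card_interedges_of_reachable hF (hcomp u v hv) S h1 h2)
  rw [Fintype.card_fin] at hbound
  exact hbound.trans (centres_bound_le hg1 hk1 hr hΓ (by linarith) hΔ)

/-- The sets output by the main loop are balls of small resistance diameter. -/
lemma effRes_le_of_loopInv {L : Matrix (Fin n) (Fin n) ℝ} (hD : IsDirichlet L)
    (hL : Conducting L) {r : ℝ} (hr : 0 < r) {q : ℕ} {M : Matrix (Fin q) (Fin n) ℝ}
    {comp : Fin n → List (Fin n)} {X : LoopState n} {U : Finset (Fin n)}
    (hM : ∀ u v, reff L u v ≤ (resM M u v).val) (hU : LoopInv M r comp X U)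
    {P : Finset (Fin n)} (hP : P ∈ X.out) {u v : Fin n} (hu : u ∈ P) (hv : v ∈ P) :
    effRes L u v ≤ ENNReal.ofReal (2 * r) := by
  rw [hL.effRes_eq]
  apply ENNReal.ofReal_le_ofReal
  obtain ⟨c, hc⟩ := hU.ball P hP
  have key : ∀ w ∈ P, reff L c w ≤ r := by
    intro w hw
    rcases hc w hw with rfl | h
    · rw [reff_self]
      exact hr.le
    · exact (hM c w).trans h
  have h1 := reff_triangle hD hL u c v
  rw [reff_comm L u c] at h1
  linarith [key u hu, key v hv]

end BallCarving

end

/-! ### The main theorem -/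

open BallCarving in
theorem mainTheorem5 (a : ℕ) :
    ∃ (K : ℝ) (c : ℕ), 0 < K ∧
      ∀ (n : ℕ) (G : SimpleGraph (Fin n)) (F : Finset (Pairs n)) (d Γ r Δ γ ε : ℝ) (k : ℕ)
        (cl : Fin n → Fin k) (H : WGraph n) (s : ℕ) (S : Matrix (Fin s) (Pairs n) ℝ)
        (decode : Matrix (Fin s) (Fin n) ℝ → Fin n → Fin n) (π : Equiv.Perm (Fin n)),
        -- `F` is a set of edges of `G`
        (∀ e ∈ F, e.1 ∈ G.edgeSet) →
        -- the minimum degree is at least `d`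
        1 ≤ d → (∀ v, d ≤ deg G v) →
        -- the clusters have small induced effective resistance diameter
        1 ≤ Γ → 0 < r → r ≤ 1 / Real.log n → 1 ≤ k →
        0 < Δ → Δ < 1 → Δ < r / Γ / (800 * Real.sqrt k) →
        (∀ i, InducedDiamLE G {v | cl v = i} Δ) →
        -- `H` is a coarse approximation of the connected network `G^γ`, with few edges
        0 ≤ γ → (0 < γ ∨ G.Connected) →
        (∀ u v, effRes (lapReg G γ) u v ≤ effRes H.laplacian u v ∧
          effRes H.laplacian u v ≤ ENNReal.ofReal (2 * Γ) * effRes (lapReg G γ) u v) →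
        0 < ε → (H.edges.card : ℝ) ≤ (Nat.log 2 n + 1 : ℝ) ^ a * (n / ε ^ 2) →
        -- `F` contains all edges of connectivity at most `d`
        (∀ e : Pairs n, ∀ u v, e.1 = s(u, v) → G.Adj u v → (edgeConn G u v : ℝ) ≤ d → e ∈ F) →
        -- `S` is a sketching matrix from which the components of `G` without `F` are decoded
        s ≤ (Nat.log 2 n + 1) ^ a →
        (∀ u v, decode (S * incidence (without G F)) u = decode (S * incidence (without G F)) v ↔
          (without G F).Reachable u v) →
        ENNReal.ofReal (1 - 1 / (n : ℝ) ^ 10) ≤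
          ProbabilityTheory.uniformOn (Set.univ : Set (Signs n)) {Q |
            let Y := S * incidence G
            let run := ballCarving a S decode Y F r H π Q
            run.val.Pairwise Disjoint ∧
            (∀ P ∈ run.val, ∀ u ∈ P, ∀ v ∈ P, effRes H.laplacian u v ≤ ENNReal.ofReal (2 * r)) ∧
            ((run.val.filter fun P => P.card ≠ 1).length : ℝ) ≤
              K * Real.log n ^ c * (Real.sqrt k + k * Γ / (r * d)) ∧
            ((removeEdges S Y F).time : ℝ) ≤ K * Real.log n ^ c * F.card ∧
            ((carveFromSketch a decode (removeEdges S Y F).val r H π Q).time : ℝ) ≤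
              K * Real.log n ^ c *
                (n * Real.sqrt k + n * (k * Γ / (r * d)) + n / ε ^ 2) ∧
            (run.space : ℝ) ≤
              K * Real.log n ^ c *
                (n * Real.sqrt k + n * (k * Γ / (r * d)) + n / ε ^ 2)} := by
  -- With `g = ⌊log₂ n⌋ + 1 ≤ 3 log n`: two factors `g ^ a` from the solver charge and the number of
  -- edges of `H`, one `g` from the number of rows, and `g ^ 5` from the number of centres.
  refine ⟨10 ^ 16 * 3 ^ (2 * a + 6), 2 * a + 6, by positivity, ?_⟩
  intro n G F d Γ r Δ γ ε k cl H s S decode π hFG hd _ hΓ hr hrn hk hΔ0 _ hΔ hdiam hγ hconn hH hε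
    hedges hF hs hdecode
  -- For `n ≤ 1` the logarithm is `0`, so `1 / Real.log n = 0` contradicts `0 < r`.
  have hn : 2 ≤ n := by
    by_contra hlt
    have : n = 0 ∨ n = 1 := by omega
    rcases this with rfl | rfl <;> simp at hrn <;> linarith
  have hcond := lapReg_conducting G hγ hconn
  -- The upper bound by resistances of `G^γ` keeps all resistances in `H` finite.
  have hHcond : Conducting H.laplacian := by
    intro u v
    refine exists_of_effRes_ne_top (ne_top_of_le_ne_top ?_ (hH u v).2)
    rw [hcond.effRes_eq]
    exact ENNReal.mul_ne_top ENNReal.ofReal_ne_top ENNReal.ofReal_ne_top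
  have hRG : ∀ u v, reff H.laplacian u v ≤ 2 * Γ * reff (lapReg G γ) u v := by
    intro u v
    have h1 := (hH u v).2
    have h0 : 0 ≤ 2 * Γ * reff (lapReg G γ) u v :=
      mul_nonneg (by linarith) (reff_nonneg (lapReg_isDirichlet G hγ) (hcond u v))
    rwa [hcond.effRes_eq, hHcond.effRes_eq, ← ENNReal.ofReal_mul (by linarith),
      ENNReal.ofReal_le_ofReal_iff h0] at h1
  refine le_uniformOn_of_norm_preserving hn (q := numRows n) (Nat.le_ceil _) (currents H) _
    fun Q hQ => ?_
  have hM := fun u v => resM_embedding_bounds a H hHcond Q (numRows_pos hn) u v (hQ u v)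
  have hval := removeEdges_val S G hFG
  obtain ⟨X, U, comp, hout, hcomp, hU, htime⟩ := carveFromSketch_spec a decode
    (removeEdges S (S * incidence G) F).val hr H π Q
  rw [hval] at hcomp
  have hcard := card_centres_le_of_loopInv hd hΓ hr hk hΔ0 hΔ hdiam hγ hcond hRG hF
    (fun u v huv => (hdecode u v).1 ((hcomp u v).1 huv).symm) (fun u v => (hM u v).2) hU
  set g : ℝ := ((Nat.log 2 n + 1 : ℕ) : ℝ) with hg
  have hg1 : 1 ≤ g := by
    rw [hg]
    exact_mod_cast Nat.le_add_left 1 _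
  have hk1 : (1 : ℝ) ≤ k := by exact_mod_cast hk
  have hsk : 1 ≤ Real.sqrt k := Real.one_le_sqrt.2 hk1
  have hterm : 0 ≤ k * Γ / (r * d) := by positivity
  set Z : ℝ := Real.sqrt k + k * Γ / (r * d) with hZ
  have hZ1 : 1 ≤ Z := by linarith
  have hgpow : g ^ (2 * a + 6) ≤ 3 ^ (2 * a + 6) * Real.log n ^ (2 * a + 6) := by
    rw [← mul_pow]
    exact pow_le_pow_left₀ (by linarith) (natLog_add_one_le hn) _
  have hKpow : 10 ^ 16 * g ^ (2 * a + 6) ≤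
      10 ^ 16 * 3 ^ (2 * a + 6) * Real.log n ^ (2 * a + 6) := by
    rw [mul_assoc]
    exact mul_le_mul_of_nonneg_left hgpow (by positivity)
  have hT : ((carveFromSketch a decode (removeEdges S (S * incidence G) F).val r H π Q).time : ℝ) ≤
      10 ^ 16 * 3 ^ (2 * a + 6) * Real.log n ^ (2 * a + 6) *
        (n * Real.sqrt k + n * (k * Γ / (r * d)) + n / ε ^ 2) := by
    rw [← mul_add, ← hZ]
    refine le_trans ?_ (mul_le_mul_of_nonneg_right hKpow (by positivity))
    rw [show g ^ (2 * a + 6) = (g ^ a) ^ 2 * g ^ 6 by ring]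
    rw [embedding_time, nearlyLinear, nearlyLinear] at htime
    have htime' := Nat.cast_le (α := ℝ).2 htime
    refine htime'.trans ?_
    have := time_bound_le (n := n) (s := s) (m := H.edges.card) (A := g ^ a) (q := numRows n)
      (t := U.card) (g := g) (Z := Z) (ε := ε) (by exact_mod_cast (by omega : 1 ≤ n))
      (by rw [hg]; exact_mod_cast hs) (Nat.cast_nonneg _) (by rw [hg]; push_cast; exact hedges)
      (one_le_pow₀ hg1) (by exact_mod_cast numRows_pos hn) (numRows_le n) hg1 (Nat.cast_nonneg _)
      hcard hZ1
    rw [hg] at this ⊢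
    push_cast at this ⊢
    exact this
  refine ⟨?_, ?_, ?_, ?_, hT, ?_⟩
  · change (carveFromSketch a decode _ r H π Q).val.Pairwise Disjoint
    rw [hout]
    exact hU.pairwise
  · intro P hP u hu v hv
    change P ∈ (carveFromSketch a decode _ r H π Q).val at hP
    rw [hout] at hP
    exact effRes_le_of_loopInv H.laplacian_isDirichlet hHcond hr (fun u v => (hM u v).1) hU hP hu hv
  · change (((carveFromSketch a decode _ r H π Q).val.filter _).length : ℝ) ≤ _
    rw [hout]
    -- The bound on centres covers all output sets, singletons included.
    have h1 : ((X.out.filter fun P => P.card ≠ 1).length : ℝ) ≤ U.card := by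
      rw [hU.card]
      exact_mod_cast List.length_filter_le _ _
    refine h1.trans (hcard.trans (mul_le_mul_of_nonneg_right (le_trans ?_ hKpow) (by linarith)))
    exact mul_le_mul (by norm_num) (pow_le_pow_right₀ hg1 (by omega)) (by positivity)
      (by norm_num)
  · rw [removeEdges_time]
    push_cast
    rw [mul_comm]
    refine mul_le_mul_of_nonneg_right (le_trans ?_ hKpow) (Nat.cast_nonneg _)
    have h1 : (s : ℝ) ≤ g ^ a := by rw [hg]; exact_mod_cast hs
    have h2 : g ^ a ≤ g ^ (2 * a + 6) := pow_le_pow_right₀ hg1 (by omega)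
    have h3 : 1 ≤ g ^ a := one_le_pow₀ hg1
    linarith
  · refine le_trans ?_ hT
    have h1 := space_carveFromSketch_le a decode (removeEdges S (S * incidence G) F).val r H π Q
    have h2 : (ballCarving a S decode (S * incidence G) F r H π Q).space =
        (removeEdges S (S * incidence G) F).space +
          (carveFromSketch a decode (removeEdges S (S * incidence G) F).val r H π Q).space := rfl
    rw [removeEdges_space, zero_add] at h2
    change ((ballCarving a S decode (S * incidence G) F r H π Q).space : ℝ) ≤ _
    rw [h2]
    exact_mod_cast h1
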